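/- A complete matching of $[2n]=\{1,\dots,2n\}$ is a partition of $[2n]$ into $n$ edges $\{a,b\}$ with $a<b$; the edge $\{a,b\}$ is nested by $\{a',b'\}$ if $a'<a<b<b'$. Give a complete matching the weight $c^k$, where $k$ is the number of its edges that are not nested by any other edge. An oscillating tableau of length $2n$ is a sequence of Ferrers shapes $\lambda^0,\dots,\lambda^{2n}$ with $\lambda^0=\lambda^{2n}=\emptyset$ in which any two consecutive shapes differ by exactly one box. Put numbers into the boxes of an oscillating tableau by reading it from right to left: when the shape gets larger, the next unused number (beginning with $1$) is put into the new box; when the shape gets smaller, the entry of the box that disappears is reverse-bumped (inverse RSK row insertion) and a number leaves the first row. Give the oscillating tableau the weight $c^k$, where $k$ is the number of those numbers that appear only in the first column, at whatever steps they are present. Given a complete matching of $[2n]$, number its edges $1,\dots,n$ from right to left by their right endpoints, and read $1,\dots,2n$ from left to right, beginning with the empty tableau: when edge $j$ starts, RSK-insert $j$; when edge $j$ ends, delete the box containing $j$. Let the shapes obtained in this way be the image of the matching. Theorem. For every $n\ge 0$ this map is a bijection from the complete matchings of $[2n]$ to the oscillating tableaux of length $2n$, and it preserves weight: the weights of a matching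 and of its image are equal, as polynomials in $c$. -/

import Mathlib

open Polynomial

noncomputable section

/-! ### Fillings of Ferrers shapes and RSK row insertion -/

/-- A Ferrers shape whose boxes hold numbers, as the list of its rows from top to bottom. Trailing
empty rows are permitted and carry no meaning. -/
abbrev Filling : Type := List (List ℕ)

namespace Filling

/-- The boxes of a filling, as pairs (row, column), both counted from 0. -/
def boxes (P : Filling) : Set (ℕ × ℕ) :=
  {p | p.2 < (P.getD p.1 []).length}

/-- The number `x` stands in row `i` and column `j` (both counted from 0) of `P`. -/
def HasEntry (P : Filling) (i j x : ℕ) : Prop :=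
  (P.getD i [])[j]? = some x

/-- Put `x` into a row: it replaces the leftmost entry that is larger than `x`, and that entry is
bumped out; if there is no larger entry, then `x` goes to the end of the row. -/
def bumpRow (x : ℕ) : List ℕ → List ℕ × Option ℕ
  | [] => ([x], none)
  | y :: ys => if x < y then (x :: ys, some y) else (y :: (bumpRow x ys).1, (bumpRow x ys).2)

/-- RSK row insertion of `x`: put `x` into the first row, the entry bumped out of it (if any)
into the second row, and so on. -/
def insert (x : ℕ) : Filling → Filling
  | [] => [[x]]
  | r :: rs =>
    match (bumpRow x r).2 with
    | none => (bumpRow x r).1 :: rs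
    | some y => (bumpRow x r).1 :: insert y rs

/-- Delete the box that contains `x`. -/
def delete (x : ℕ) (P : Filling) : Filling :=
  P.map fun r => r.erase x

/-- Reverse of `bumpRow`: `y` replaces the rightmost entry that is smaller than `y`, and that entry
is returned. (In an increasing row whose first entry is smaller than `y`; the other cases do not
occur in what follows.) -/
def unbumpRow (y : ℕ) : List ℕ → List ℕ × ℕ
  | [] => ([], y)
  | [x] => ([y], x)
  | x :: x' :: xs =>
    if x' < y then (x :: (unbumpRow y (x' :: xs)).1, (unbumpRow y (x' :: xs)).2)
    else (y :: x' :: xs, x)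

/-- Reverse of RSK row insertion: remove the last box of row `i`, unbump its entry through the rows
above it, and return the remaining filling with the number which leaves the first row. -/
def unbump : ℕ → Filling → Filling × ℕ
  | _, [] => ([], 0)
  | 0, r :: rs => (r.dropLast :: rs, r.getLastD 0)
  | i + 1, r :: rs =>
    ((unbumpRow (unbump i rs).2 r).1 :: (unbump i rs).1, (unbumpRow (unbump i rs).2 r).2)

/-- Add a box that contains `x` at the end of row `i`. -/
def addBox (x : ℕ) : ℕ → Filling → Filling
  | 0, [] => [[x]]
  | 0, r :: rs => (r ++ [x]) :: rs
  | i + 1, [] => [] :: addBox x i []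
  | i + 1, r :: rs => r :: addBox x i rs

end Filling

/-! ### Oscillating tableaux -/

/-- An oscillating tableau of length `m`: a path with `m` edges in the Hasse diagram of the Young
lattice which begins and ends with the empty shape. -/
structure OscillatingTableau (m : ℕ) where
  /-- The sequence of shapes. -/
  shape : Fin (m + 1) → YoungDiagram
  first : shape 0 = ⊥
  last : shape (Fin.last m) = ⊥
  step : ∀ k : Fin m, shape k.castSucc ⋖ shape k.succ ∨ shape k.succ ⋖ shape k.castSucc

namespace OscillatingTableau

variable {m : ℕ} (T : OscillatingTableau m)

/-- Step `k`, read from left to right, removes a box. -/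
def IsDown (k : Fin m) : Prop := T.shape k.succ ⋖ T.shape k.castSucc

open Classical in
/-- The number that is put into the new box when the sequence of shapes is read from right to left
and step `k` makes the shape larger: the first new box gets 1, the next one gets 2, and so on. -/
def label (k : Fin m) : ℕ :=
  (Finset.univ.filter fun k' : Fin m => k ≤ k' ∧ T.IsDown k').card

/-- The row of the box in which the two shapes at step `k` differ. -/
def changedRow (k : Fin m) : ℕ :=
  (symmDiff (T.shape k.castSucc).cells (T.shape k.succ).cells).sup Prod.fst

open Classical in
/-- The numbers in the shapes of an oscillating tableau, found by reading it from right to left: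
when the shape gets larger, the next number is put into the new box; when it gets smaller, the
numbers are unbumped so that the box disappears. -/
def filling : Fin (m + 1) → Filling :=
  Fin.reverseInduction (motive := fun _ => Filling) []
    (fun k P => if T.IsDown k then P.addBox (T.label k) (T.changedRow k)
      else (P.unbump (T.changedRow k)).1)

open Classical in
/-- The set of all numbers that are put into the shapes of `T`. -/
def numbers : Finset ℕ :=
  (Finset.univ.filter fun k : Fin m => T.IsDown k).image T.label

/-- Wherever the number `x` appears in the shapes of `T`, it is in the first column. -/
def FirstColumnOnly (x : ℕ) : Prop :=
  ∀ (k : Fin (m + 1)) (i j : ℕ), (T.filling k).HasEntry i j x → j = 0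

open Classical in
/-- The weight of an oscillating tableau, a polynomial in `c = X`: the numbers that appear in the
first column only have weight `c`, and all other numbers have weight 1. -/
def weight : ℤ[X] :=
  ∏ x ∈ T.numbers, if T.FirstColumnOnly x then X else 1

end OscillatingTableau

/-! ### Complete matchings -/

/-- Complete matchings of `2 * n` linearly ordered points. -/
abbrev CompleteMatching (n : ℕ) : Type :=
  {M : (⊤ : SimpleGraph (Fin (2 * n))).Subgraph // M.IsPerfectMatching}

namespace CompleteMatching

variable {n : ℕ} (M : CompleteMatching n)

open Classical in
/-- The edges of a matching, as pairs (left end, right end). -/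
def arcs : Finset (Fin (2 * n) × Fin (2 * n)) :=
  Finset.univ.filter fun p => p.1 < p.2 ∧ M.1.Adj p.1 p.2

/-- The edge `p` is nested by another edge of the matching. -/
def IsNested (p : Fin (2 * n) × Fin (2 * n)) : Prop :=
  ∃ q ∈ M.arcs, q.1 < p.1 ∧ p.2 < q.2

open Classical in
/-- The weight of a complete matching, a polynomial in `c = X`: edges that are not nested by any
other edge have weight `c`, and all other edges have weight 1. -/
def weight : ℤ[X] :=
  ∏ p ∈ M.arcs, if M.IsNested p then 1 else X

/-- An edge starts at the vertex `v`. -/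
def IsStart (v : Fin (2 * n)) : Prop := ∃ w, v < w ∧ M.1.Adj v w

open Classical in
/-- The number of the edge at the vertex `v`, when the edges are numbered `1, 2, …, n` from right to
left by their right ends: it counts the edges whose right end is weakly to the right of the edge
at `v`. -/
def label (v : Fin (2 * n)) : ℕ :=
  (M.arcs.filter fun p => v ≤ p.2 ∧ ∀ w, M.1.Adj v w → w ≤ p.2).card

open Classical in
/-- Read the matching from left to right, beginning with the empty shape; when edge `j` starts,
RSK-insert `j`; when edge `j` ends, delete the box containing `j`. -/
def filling : Fin (2 * n + 1) → Filling :=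
  Fin.induction (motive := fun _ => Filling) []
    (fun v P => if M.IsStart v then P.insert (M.label v) else P.delete (M.label v))

end CompleteMatching

end

/-! Edges are numbered by right ends from right to left, so an edge that closes earlier has a larger
number. The entries of the filling at any moment are the numbers of the open edges (`OpenLabels`),
and the edge that closes next carries the largest of them. That entry occupies a corner, so deleting
it leaves a tableau (`IsTableau.exists_addBox_delete`), and row insertion of course keeps tableaux;
hence the shapes exist and change by one box at a time.

Each step can be undone from the shapes alone. An insertion is undone by unbumping from the new
corner (`IsTableau.exists_unbump_insert`); a deletion is undone by adding the box back, and the lost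
entry is the number of down steps from there on. So reading the shapes from right to left recovers
the fillings (`CompleteMatching.filling_toTableau`) and the label at every vertex, and the labels
determine the matching (`CompleteMatching.adj_iff`).

Conversely, in the right-to-left reading of an oscillating tableau each new number exceeds all those
present, so every filling is a tableau. Every number enters once and, since the shape ends up empty,
leaves once; these two steps are joined by an edge (`existsUnique_stepLabel_eq`). Reading this
matching forwards retraces the same fillings, because inserting undoes unbumping
(`IsTableau.insert_unbump`).

For the weights, suppose an edge starts. If some open edge nests it, a smaller entry is present, the
first row begins with a smaller entry, and the new number lands outside the first column. Otherwise
all entries present are larger and it lands in the first column; it stays there, since a number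
bumped out of the first column meets only larger entries below (`IsTableau.firstColumn_insert`).

Fillings are lists of rows that may end in empty rows, so they are compared by `Eqv` rather than by
equality. -/

noncomputable section

/-! ### Rows of fillings, equality up to trailing empty rows, tableaux. -/

namespace Filling

/-- Row `i` of a filling, which is empty beyond the last row. -/
abbrev row (P : Filling) (i : ℕ) : List ℕ := P.getD i []

/-- Two fillings agree up to trailing empty rows. -/
def Eqv (P Q : Filling) : Prop := ∀ i, P.row i = Q.row i

theorem Eqv.refl (P : Filling) : Eqv P P := fun _ => rfl

theorem Eqv.symm {P Q : Filling} (h : Eqv P Q) : Eqv Q P := fun i => (h i).symm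

theorem Eqv.trans {P Q R : Filling} (h : Eqv P Q) (h' : Eqv Q R) : Eqv P R :=
  fun i => (h i).trans (h' i)

theorem eqv_cons {r s : List ℕ} {P Q : Filling} (hr : r = s) (h : Eqv P Q) :
    Eqv (r :: P) (s :: Q) := by
  rintro (_ | i)
  · simpa [row] using hr
  · simpa [row] using h i

theorem Eqv.tail {r s : List ℕ} {P Q : Filling} (h : Eqv (r :: P) (s :: Q)) : Eqv P Q :=
  fun i => by simpa [row] using h (i + 1)

theorem Eqv.head {r s : List ℕ} {P Q : Filling} (h : Eqv (r :: P) (s :: Q)) : r = s := by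
  simpa [row] using h 0

theorem Eqv.nil_tail {s : List ℕ} {Q : Filling} (h : Eqv [] (s :: Q)) : Eqv [] Q :=
  fun i => by simpa [row] using h (i + 1)

theorem Eqv.nil_head {s : List ℕ} {Q : Filling} (h : Eqv [] (s :: Q)) : s = [] := by
  simpa [row] using (h 0).symm

theorem Eqv.flatten_nil : ∀ {Q : Filling}, Eqv [] Q → Q.flatten = []
  | [], _ => rfl
  | s :: Q, h => by
    simp only [List.flatten_cons, h.nil_head, h.nil_tail.flatten_nil, List.append_nil]

theorem Eqv.flatten_eq : ∀ {P Q : Filling}, Eqv P Q → P.flatten = Q.flatten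
  | [], Q, h => by rw [h.flatten_nil]; rfl
  | P, [], h => by rw [h.symm.flatten_nil]; rfl
  | r :: P, s :: Q, h => by
    simp only [List.flatten_cons, h.head, h.tail.flatten_eq]

theorem mem_flatten_iff {P : Filling} {x : ℕ} : x ∈ P.flatten ↔ ∃ i, x ∈ P.row i := by
  induction P with
  | nil => simp [row]
  | cons r P ih =>
    rw [List.flatten_cons, List.mem_append, ih]
    constructor
    · rintro (h | ⟨i, h⟩)
      · exact ⟨0, by simpa [row] using h⟩
      · exact ⟨i + 1, by simpa [row] using h⟩
    · rintro ⟨_ | i, h⟩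
      · exact Or.inl (by simpa [row] using h)
      · exact Or.inr ⟨i, by simpa [row] using h⟩

theorem row_nodup {P : Filling} (h : P.flatten.Nodup) (i : ℕ) : (P.row i).Nodup := by
  induction P generalizing i with
  | nil => simp [row]
  | cons r P ih =>
    rw [List.flatten_cons, List.nodup_append'] at h
    rcases i with _ | i
    · simpa [row] using h.1
    · simpa [row] using ih h.2.1 i

theorem row_unique {P : Filling} (h : P.flatten.Nodup) {i k x : ℕ} (hi : x ∈ P.row i)
    (hk : x ∈ P.row k) : i = k := by
  induction P generalizing i k with
  | nil => simp [row] at hi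
  | cons r P ih =>
    rw [List.flatten_cons, List.nodup_append'] at h
    rcases i with _ | i <;> rcases k with _ | k
    · rfl
    · exact (h.2.2 (by simpa [row] using hi)
        (mem_flatten_iff.2 ⟨k, by simpa [row] using hk⟩)).elim
    · exact (h.2.2 (by simpa [row] using hk)
        (mem_flatten_iff.2 ⟨i, by simpa [row] using hi⟩)).elim
    · rw [ih h.2.1 (i := i) (k := k) (by simpa [row] using hi) (by simpa [row] using hk)]

/-- Each entry of `s` stands below a smaller entry of `r`. -/
def Dom (r s : List ℕ) : Prop :=
  ∀ (j y : ℕ), s[j]? = some y → ∃ z, r[j]? = some z ∧ z < y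

theorem Dom.length_le {r s : List ℕ} (h : Dom r s) : s.length ≤ r.length := by
  by_contra! hlt
  obtain ⟨z, hz, -⟩ := h r.length s[r.length] (List.getElem?_eq_getElem hlt)
  simp at hz

theorem Dom.nil (r : List ℕ) : Dom r [] := fun j y h => by simp at h

theorem Dom.of_prefix_right {r s s' : List ℕ} (h : Dom r s) (hs : s' <+: s) : Dom r s' := by
  intro j y hj
  obtain ⟨t, rfl⟩ := hs
  refine h j y ?_
  rw [List.getElem?_append_left (List.getElem?_eq_some_iff.1 hj).1, hj]

theorem Dom.of_prefix_left {r r' s : List ℕ} (h : Dom r s) (hr : r <+: r') : Dom r' s := by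
  intro j y hj
  obtain ⟨t, rfl⟩ := hr
  obtain ⟨z, hz, hzy⟩ := h j y hj
  exact ⟨z, by rw [List.getElem?_append_left (List.getElem?_eq_some_iff.1 hz).1, hz], hzy⟩

/-- A semistandard tableau: rows increase weakly, columns increase strictly. -/
structure IsTableau (P : Filling) : Prop where
  sorted : ∀ i, (P.row i).Pairwise (· ≤ ·)
  dom : ∀ i, Dom (P.row i) (P.row (i + 1))

theorem isTableau_nil : IsTableau [] :=
  ⟨fun i => by simp [row], fun i => by simpa [row] using Dom.nil _⟩

theorem isTableau_cons {r : List ℕ} {P : Filling} :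
    IsTableau (r :: P) ↔ r.Pairwise (· ≤ ·) ∧ Dom r (P.row 0) ∧ IsTableau P := by
  constructor
  · intro h
    exact ⟨by simpa [row] using h.sorted 0, by simpa [row] using h.dom 0,
      fun i => by simpa [row] using h.sorted (i + 1), fun i => by simpa [row] using h.dom (i + 1)⟩
  · rintro ⟨h1, h2, h3⟩
    refine ⟨?_, ?_⟩ <;> rintro (_ | i)
    · simpa [row] using h1
    · simpa [row] using h3.sorted i
    · simpa [row] using h2
    · simpa [row] using h3.dom i

/-! ### Bumping in a row -/

theorem bumpRow_of_forall_le {x : ℕ} {r : List ℕ} (h : ∀ a ∈ r, a ≤ x) :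
    bumpRow x r = (r ++ [x], none) := by
  induction r with
  | nil => rfl
  | cons a r ih =>
    rw [List.forall_mem_cons] at h
    simp [bumpRow, not_lt.2 h.1, ih h.2]

theorem bumpRow_of_lt {x y : ℕ} {A B : List ℕ} (hA : ∀ a ∈ A, a ≤ x) (hxy : x < y) :
    bumpRow x (A ++ y :: B) = (A ++ x :: B, some y) := by
  induction A with
  | nil => simp [bumpRow, hxy]
  | cons a A ih =>
    rw [List.forall_mem_cons] at hA
    simp [bumpRow, not_lt.2 hA.1, ih hA.2]

/-- Splits the row at its leftmost entry larger than `x`, so no sortedness is needed. Most later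
arguments about insertion start from this dichotomy. -/
theorem bumpRow_cases (x : ℕ) (r : List ℕ) :
    (∀ a ∈ r, a ≤ x) ∨ ∃ A y B, r = A ++ y :: B ∧ (∀ a ∈ A, a ≤ x) ∧ x < y := by
  induction r with
  | nil => simp
  | cons a r ih =>
    by_cases ha : x < a
    · exact Or.inr ⟨[], a, r, rfl, by simp, ha⟩
    · rcases ih with h | ⟨A, y, B, rfl, hA, hxy⟩
      · exact Or.inl (List.forall_mem_cons.2 ⟨not_lt.1 ha, h⟩)
      · exact Or.inr ⟨a :: A, y, B, rfl, List.forall_mem_cons.2 ⟨not_lt.1 ha, hA⟩, hxy⟩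

/-- The hypotheses make `x` the rightmost entry smaller than `y`, which is the one that `unbumpRow`
replaces. -/
theorem unbumpRow_eq {x y : ℕ} {A B : List ℕ} (hA : ∀ a ∈ A, a ≤ x) (hxy : x < y)
    (hB : ∀ b ∈ B, y ≤ b) : unbumpRow y (A ++ x :: B) = (A ++ y :: B, x) := by
  induction A with
  | nil =>
    rcases B with _ | ⟨b, B⟩
    · rfl
    · have : ¬ b < y := not_lt.2 (hB b (by simp))
      simp [unbumpRow, this]
  | cons a A ih =>
    rw [List.forall_mem_cons] at hA
    rcases A with _ | ⟨a', A⟩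
    · have := ih (by simp)
      simp only [List.nil_append] at this
      simp [unbumpRow, hxy, this]
    · have h := ih hA.2
      have : a' < y := (hA.2 a' (by simp)).trans_lt hxy
      simp only [List.cons_append] at h
      simp [unbumpRow, this, h]

theorem exists_split_of_lt {y : ℕ} {r : List ℕ} (hr : r.Pairwise (· ≤ ·)) {a : ℕ} (ha : a ∈ r)
    (hay : a < y) : ∃ A x B, r = A ++ x :: B ∧ x < y ∧ ∀ b ∈ B, y ≤ b := by
  induction r generalizing a with
  | nil => simp at ha
  | cons b r ih =>
    rw [List.pairwise_cons] at hr
    by_cases h : ∃ a ∈ r, a < y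
    · obtain ⟨c, hc, hcy⟩ := h
      obtain ⟨A, x, B, rfl, h1, h2⟩ := ih hr.2 hc hcy
      exact ⟨b :: A, x, B, rfl, h1, h2⟩
    · push Not at h
      refine ⟨[], b, r, rfl, ?_, h⟩
      rcases List.mem_cons.1 ha with rfl | ha
      · exact hay
      · exact absurd hay (not_lt.2 (h a ha))

theorem pairwise_mid {A B : List ℕ} {x : ℕ} : (A ++ x :: B).Pairwise (· ≤ ·) ↔
    A.Pairwise (· ≤ ·) ∧ B.Pairwise (· ≤ ·) ∧ (∀ a ∈ A, a ≤ x) ∧ (∀ b ∈ B, x ≤ b) ∧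
      ∀ a ∈ A, ∀ b ∈ B, a ≤ b := by
  simp only [List.pairwise_append, List.pairwise_cons, List.mem_cons]
  constructor
  · rintro ⟨h1, ⟨h2, h3⟩, h4⟩
    exact ⟨h1, h3, fun a ha => h4 a ha x (Or.inl rfl), h2, fun a ha b hb => h4 a ha b (Or.inr hb)⟩
  · rintro ⟨h1, h2, h3, h4, h5⟩
    exact ⟨h1, ⟨h4, h2⟩, fun a ha b hb => hb.elim (fun h => h ▸ h3 a ha) (h5 a ha b)⟩

theorem getElem?_mid (A B : List ℕ) (x j : ℕ) : (A ++ x :: B)[j]? =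
    if j < A.length then A[j]? else if j = A.length then some x else B[j - A.length - 1]? := by
  rw [List.getElem?_append]
  split_ifs with h1 h2
  · rfl
  · simp [h2]
  · rw [show j - A.length = (j - A.length - 1) + 1 by omega, List.getElem?_cons_succ]
    simp

theorem pairwise_bumpRow {x : ℕ} {r : List ℕ} (hr : r.Pairwise (· ≤ ·)) :
    (bumpRow x r).1.Pairwise (· ≤ ·) := by
  rcases bumpRow_cases x r with h | ⟨A, y, B, rfl, hA, hxy⟩
  · rw [bumpRow_of_forall_le h]
    simpa [List.pairwise_append] using ⟨hr, h⟩
  · rw [bumpRow_of_lt hA hxy]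
    rw [pairwise_mid] at hr ⊢
    exact ⟨hr.1, hr.2.1, hA, fun b hb => hxy.le.trans (hr.2.2.2.1 b hb), hr.2.2.2.2⟩

/-- Treats bumping and appending alike: in both cases `x` lands in column `A.length`. This keeps the
column arguments free of a premature case split. -/
theorem bumpRow_shape (x : ℕ) (s : List ℕ) : ∃ A B C, s = A ++ C ∧ (bumpRow x s).1 = A ++ x :: B ∧
    (∀ a ∈ A, a ≤ x) ∧ ((C = [] ∧ B = []) ∨ ∃ y, x < y ∧ C = y :: B) := by
  rcases bumpRow_cases x s with h | ⟨A, y, B, rfl, hA, hxy⟩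
  · exact ⟨s, [], [], by simp, by rw [bumpRow_of_forall_le h], h, Or.inl ⟨rfl, rfl⟩⟩
  · exact ⟨A, B, y :: B, rfl, by rw [bumpRow_of_lt hA hxy], hA, Or.inr ⟨y, hxy, rfl⟩⟩

/-- Bumping moves entries weakly to the left, so that columns stay increasing. -/
theorem dom_bumpRow {x y : ℕ} {A B s : List ℕ} (h : Dom (A ++ y :: B) s) (hA : ∀ a ∈ A, a ≤ x)
    (hxy : x < y) : Dom (A ++ x :: B) (bumpRow y s).1 := by
  obtain ⟨A', B', C', rfl, h2, hA', hC⟩ := bumpRow_shape y s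
  -- `y` lands weakly left of where it stood: an entry of `s` directly below `y` exceeds `y`, so it
  -- cannot belong to `A'`.
  have hle : A'.length ≤ A.length := by
    by_contra! hlt
    have h1 : (A' ++ C')[A.length]? = some A'[A.length] := by
      rw [List.getElem?_append_left hlt, List.getElem?_eq_getElem hlt]
    obtain ⟨z, hz, hzy⟩ := h _ _ h1
    simp at hz
    have := hA' A'[A.length] (List.getElem_mem hlt)
    omega
  rw [h2]
  intro j w hj
  have hmid : ∀ z, (A ++ y :: B)[j]? = some z → z < w →
      ∃ z, (A ++ x :: B)[j]? = some z ∧ z < w := by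
    intro z hz hzw
    rw [getElem?_mid] at hz ⊢
    split_ifs at hz ⊢ with h3 h4
    · exact ⟨z, hz, hzw⟩
    · exact ⟨x, rfl, by simp at hz; omega⟩
    · exact ⟨z, hz, hzw⟩
  rw [getElem?_mid] at hj
  split_ifs at hj with h3 h4
  · obtain ⟨z, hz, hzw⟩ := h j w (by rw [List.getElem?_append_left h3, hj])
    exact hmid z hz hzw
  · obtain rfl : y = w := by simpa using hj
    rw [getElem?_mid]
    split_ifs with h5 h6
    · exact ⟨A[j], List.getElem?_eq_getElem h5, (hA _ (List.getElem_mem h5)).trans_lt hxy⟩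
    · exact ⟨x, rfl, hxy⟩
    · omega
  · rcases hC with ⟨rfl, rfl⟩ | ⟨z, hz, rfl⟩
    · simp at hj
    · obtain ⟨z, hz, hzw⟩ := h j w (by rw [getElem?_mid, if_neg h3, if_neg h4, hj])
      exact hmid z hz hzw

/-- The converse of `dom_bumpRow`. Above the place where `y` lands stands an entry smaller than `y`,
so the rightmost such entry `x` of `r` lies weakly to the right of that place. From there on the
entries of `s` exceed `y`, so `y` may take the place of `x`. -/
theorem dom_unbumpRow {y : ℕ} {r s : List ℕ} (hr : r.Pairwise (· ≤ ·))
    (hs : s.Pairwise (· ≤ ·)) (h : Dom r (bumpRow y s).1) :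
    ∃ A x B, r = A ++ x :: B ∧ (∀ a ∈ A, a ≤ x) ∧ x < y ∧ (∀ b ∈ B, y ≤ b) ∧
      Dom (A ++ y :: B) s := by
  obtain ⟨A', B', C', rfl, h2, hA', hC⟩ := bumpRow_shape y s
  rw [h2] at h
  obtain ⟨a, ha, hay⟩ := h A'.length y (by simp)
  obtain ⟨A, x, B, rfl, hxy, hB⟩ := exists_split_of_lt hr (List.mem_of_getElem? ha) hay
  have hr' := pairwise_mid.1 hr
  refine ⟨A, x, B, rfl, hr'.2.2.1, hxy, hB, ?_⟩
  have hle : A'.length ≤ A.length := by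
    by_contra! hlt
    rw [getElem?_mid, if_neg (by omega), if_neg (by omega)] at ha
    have := hB a (List.mem_of_getElem? ha)
    omega
  intro j w hj
  have hmid : ∀ z, (A ++ x :: B)[j]? = some z → z < w → y < w ∨ j < A'.length →
      ∃ z, (A ++ y :: B)[j]? = some z ∧ z < w := by
    intro z hz hzw hw
    rw [getElem?_mid] at hz ⊢
    split_ifs at hz ⊢ with h3 h4
    · exact ⟨z, hz, hzw⟩
    · exact ⟨y, rfl, by omega⟩
    · exact ⟨z, hz, hzw⟩
  by_cases h3 : j < A'.length
  · rw [List.getElem?_append_left h3] at hj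
    obtain ⟨z, hz, hzw⟩ := h j w (by rw [List.getElem?_append_left h3, hj])
    exact hmid z hz hzw (Or.inr h3)
  · rcases hC with ⟨rfl, rfl⟩ | ⟨z, hz, rfl⟩
    · rw [List.append_nil, List.getElem?_eq_none (not_lt.1 h3)] at hj
      simp at hj
    · have hs' := pairwise_mid.1 hs
      rw [getElem?_mid, if_neg h3] at hj
      split_ifs at hj with h4
      · obtain rfl : z = w := by simpa using hj
        subst h4
        exact hmid a ha (by omega) (Or.inl hz)
      · obtain ⟨u, hu, huw⟩ := h j w (by rw [getElem?_mid, if_neg h3, if_neg h4, hj])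
        have := hs'.2.2.2.1 w (List.mem_of_getElem? hj)
        exact hmid u hu huw (Or.inl (by omega))

end Filling

namespace Filling

/-! ### Row insertion into a tableau -/

/-- The row lengths `ν` arise from the row lengths `μ` by adding a box to row `i`. -/
def Adds (i : ℕ) (μ ν : ℕ → ℕ) : Prop := ∀ k, ν k = μ k + if k = i then 1 else 0

theorem Adds.succ {i : ℕ} {r r' : List ℕ} {P Q : Filling} (hr : r'.length = r.length)
    (h : Adds i (fun k => (P.row k).length) fun k => (Q.row k).length) :
    Adds (i + 1) (fun k => (row (r :: P) k).length) fun k => (row (r' :: Q) k).length := by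
  rintro (_ | k)
  · simpa [row] using hr
  · simpa [row] using h k

theorem Adds.zero {x : ℕ} {r : List ℕ} {P : Filling} :
    Adds 0 (fun k => (row (r :: P) k).length) fun k => (row ((r ++ [x]) :: P) k).length := by
  rintro (_ | k) <;> simp [row]

theorem insert_nil (x : ℕ) : insert x [] = [[x]] := rfl

theorem insert_cons_of_forall_le {x : ℕ} {r : List ℕ} (h : ∀ a ∈ r, a ≤ x) (P : Filling) :
    insert x (r :: P) = (r ++ [x]) :: P := by
  simp [insert, bumpRow_of_forall_le h]

theorem insert_cons_of_lt {x y : ℕ} {A B : List ℕ} (hA : ∀ a ∈ A, a ≤ x) (hxy : x < y)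
    (P : Filling) : insert x ((A ++ y :: B) :: P) = (A ++ x :: B) :: insert y P := by
  simp [insert, bumpRow_of_lt hA hxy]

theorem row_zero_insert (x : ℕ) (P : Filling) : (insert x P).row 0 = (bumpRow x (P.row 0)).1 := by
  rcases P with _ | ⟨r, P⟩
  · rfl
  · rcases bumpRow_cases x r with h | ⟨A, y, B, rfl, hA, hxy⟩
    · rw [insert_cons_of_forall_le h]
      simp [row, bumpRow_of_forall_le h]
    · rw [insert_cons_of_lt hA hxy]
      simp [row, bumpRow_of_lt hA hxy]

theorem insert_eqv {P Q : Filling} (h : Eqv P Q) (x : ℕ) : Eqv (insert x P) (insert x Q) := by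
  induction P generalizing Q x with
  | nil =>
    rcases Q with _ | ⟨s, Q⟩
    · exact Eqv.refl _
    · obtain rfl := h.nil_head
      exact eqv_cons rfl h.nil_tail
  | cons r P ih =>
    rcases Q with _ | ⟨s, Q⟩
    · obtain rfl := h.symm.nil_head
      exact eqv_cons rfl h.symm.nil_tail.symm
    · obtain rfl := h.head
      rcases bumpRow_cases x r with hr | ⟨A, y, B, rfl, hA, hxy⟩
      · rw [insert_cons_of_forall_le hr, insert_cons_of_forall_le hr]
        exact eqv_cons rfl h.tail
      · rw [insert_cons_of_lt hA hxy, insert_cons_of_lt hA hxy]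
        exact eqv_cons rfl (ih h.tail y)

theorem unbump_nil (i : ℕ) : unbump i [] = ([], 0) := by
  cases i <;> rfl

/-- Ensures that the default value 0 returned by `unbump` does not depend on trailing empty rows: an
empty row passes the 0 on unchanged. -/
theorem unbump_nil_eqv {i : ℕ} {Q : Filling} (h : Eqv [] Q) :
    Eqv [] (unbump i Q).1 ∧ (unbump i Q).2 = 0 := by
  induction Q generalizing i with
  | nil => simp [unbump_nil, Eqv.refl]
  | cons s Q ih =>
    obtain rfl := h.nil_head
    rcases i with _ | i
    · exact ⟨h, rfl⟩
    · obtain ⟨h1, h2⟩ := ih (i := i) h.nil_tail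
      refine ⟨?_, by simp [unbump, unbumpRow, h2]⟩
      rintro (_ | k)
      · simp [row, unbump, unbumpRow]
      · simpa [row, unbump] using h1 k

theorem unbump_eqv {P Q : Filling} (h : Eqv P Q) (i : ℕ) :
    Eqv (unbump i P).1 (unbump i Q).1 ∧ (unbump i P).2 = (unbump i Q).2 := by
  induction P generalizing Q i with
  | nil =>
    rw [unbump_nil]
    exact ⟨(unbump_nil_eqv h).1, (unbump_nil_eqv h).2.symm⟩
  | cons r P ih =>
    rcases Q with _ | ⟨s, Q⟩
    · rw [unbump_nil]
      exact ⟨(unbump_nil_eqv h.symm).1.symm, (unbump_nil_eqv h.symm).2⟩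
    · obtain rfl := h.head
      rcases i with _ | i
      · exact ⟨eqv_cons rfl h.tail, rfl⟩
      · obtain ⟨h1, h2⟩ := ih h.tail i
        simp only [unbump, h2]
        exact ⟨eqv_cons rfl h1, trivial⟩

theorem perm_insert (x : ℕ) (P : Filling) : (insert x P).flatten.Perm (x :: P.flatten) := by
  induction P generalizing x with
  | nil => simp [insert_nil]
  | cons r P ih =>
    rcases bumpRow_cases x r with hr | ⟨A, y, B, rfl, hA, hxy⟩
    · rw [insert_cons_of_forall_le hr]
      simp only [List.flatten_cons, List.append_assoc, List.singleton_append]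
      exact List.perm_middle
    · rw [insert_cons_of_lt hA hxy]
      simp only [List.flatten_cons, List.append_assoc, List.cons_append]
      refine List.perm_middle.trans (List.Perm.cons x (List.Perm.append_left A ?_))
      exact ((ih y).append_left B).trans List.perm_middle

theorem IsTableau.insert {P : Filling} (hP : IsTableau P) (x : ℕ) : IsTableau (insert x P) := by
  induction P generalizing x with
  | nil =>
    rw [insert_nil, isTableau_cons]
    exact ⟨by simp, by simpa [row] using Dom.nil _, isTableau_nil⟩
  | cons r P ih =>
    have hP' := hP
    rw [isTableau_cons] at hP'
    obtain ⟨h1, h2, h3⟩ := hP'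
    have h4 := pairwise_bumpRow (x := x) h1
    rcases bumpRow_cases x r with hr | ⟨A, y, B, rfl, hA, hxy⟩
    · rw [bumpRow_of_forall_le hr] at h4
      rw [insert_cons_of_forall_le hr, isTableau_cons]
      exact ⟨h4, h2.of_prefix_left (List.prefix_append _ _), h3⟩
    · rw [bumpRow_of_lt hA hxy] at h4
      rw [insert_cons_of_lt hA hxy, isTableau_cons]
      exact ⟨h4, row_zero_insert y P ▸ dom_bumpRow h2 hA hxy, ih h3 y⟩

/-- Unbumping from the row where the insertion stopped retraces the bumping path: in each row
passed, the inserted number is the rightmost entry smaller than the one it bumped out. -/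
theorem IsTableau.exists_unbump_insert {P : Filling} (hP : IsTableau P) (x : ℕ) :
    ∃ i, Adds i (fun k => (P.row k).length) (fun k => ((Filling.insert x P).row k).length) ∧
      Eqv (unbump i (Filling.insert x P)).1 P ∧ (unbump i (Filling.insert x P)).2 = x := by
  induction P generalizing x with
  | nil =>
    refine ⟨0, ?_, ?_, rfl⟩ <;> rintro (_ | k) <;> simp [row, insert_nil, unbump]
  | cons r P ih =>
    rw [isTableau_cons] at hP
    obtain ⟨h1, h2, h3⟩ := hP
    rcases bumpRow_cases x r with hr | ⟨A, y, B, rfl, hA, hxy⟩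
    · rw [insert_cons_of_forall_le hr]
      refine ⟨0, Adds.zero, ?_, ?_⟩ <;> simp [unbump, Eqv.refl]
    · obtain ⟨i, h4, h5, h6⟩ := ih h3 y
      rw [insert_cons_of_lt hA hxy]
      refine ⟨i + 1, Adds.succ (by simp) h4, ?_, ?_⟩ <;>
        simp only [unbump, h6, unbumpRow_eq hA hxy (pairwise_mid.1 h1).2.2.2.1]
      exact eqv_cons rfl h5

/-- The hypothesis says that row `i` ends in a corner. By induction the rows below are the result of
an insertion, which is the form of the column condition that `dom_unbumpRow` needs to unbump the row
above. -/
theorem IsTableau.insert_unbump {P : Filling} (hP : IsTableau P) {i : ℕ}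
    (hi : (P.row (i + 1)).length < (P.row i).length) :
    IsTableau (unbump i P).1 ∧ Eqv (Filling.insert (unbump i P).2 (unbump i P).1) P ∧
      Adds i (fun k => ((unbump i P).1.row k).length) fun k => (P.row k).length := by
  induction P generalizing i with
  | nil => simp [row] at hi
  | cons r P ih =>
    rw [isTableau_cons] at hP
    obtain ⟨h1, h2, h3⟩ := hP
    rcases i with _ | i
    · rcases List.eq_nil_or_concat r with rfl | ⟨A, x, rfl⟩
      · simp [row] at hi
      · have h1' : A.Pairwise (· ≤ ·) ∧ ∀ a ∈ A, a ≤ x := by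
          simpa [List.pairwise_append] using h1
        have hx : unbump 0 ((A ++ [x]) :: P) = (A :: P, x) := by simp [unbump]
        rw [List.concat_eq_append] at *
        rw [hx]
        refine ⟨isTableau_cons.2 ⟨h1'.1, ?_, h3⟩, ?_, Adds.zero⟩
        · intro j y hj
          obtain ⟨z, hz, hzy⟩ := h2 j y hj
          have : j < A.length := by
            have h5 := (List.getElem?_eq_some_iff.1 hj).1
            simp [row] at hi h5
            omega
          exact ⟨z, by rw [← hz, List.getElem?_append_left this], hzy⟩
        · rw [insert_cons_of_forall_le h1'.2]
          exact Eqv.refl _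
    · obtain ⟨h4, h5, h6⟩ := ih h3 (i := i) (by simpa [row] using hi)
      rw [← h5 0, row_zero_insert] at h2
      obtain ⟨A, x, B, rfl, hA, hxy, hB, hdom⟩ := dom_unbumpRow h1 (h4.sorted 0) h2
      simp only [unbump, unbumpRow_eq hA hxy hB]
      refine ⟨isTableau_cons.2 ⟨?_, hdom, h4⟩, ?_, Adds.succ (by simp) h6⟩
      · rw [pairwise_mid] at h1 ⊢
        exact ⟨h1.1, h1.2.1, fun a ha => (hA a ha).trans hxy.le, hB, h1.2.2.2.2⟩
      · rw [insert_cons_of_lt hA hxy]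
        exact eqv_cons rfl h5

/-! ### Adding and deleting a box with the largest entry -/

theorem row_nil (k : ℕ) : row [] k = [] := by simp [row]

theorem row_addBox (x i : ℕ) (P : Filling) (k : ℕ) :
    (addBox x i P).row k = if k = i then P.row k ++ [x] else P.row k := by
  induction i generalizing P k with
  | zero => rcases P with _ | ⟨r, P⟩ <;> rcases k with _ | k <;> simp [row, addBox]
  | succ i ih =>
    rcases P with _ | ⟨r, P⟩ <;> rcases k with _ | k
    · simp [row, addBox]
    · have := ih [] k
      rw [row_nil] at this
      simpa [row, addBox] using this
    · simp [row, addBox]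
    · simpa [row, addBox] using ih P k

theorem addBox_eqv {P Q : Filling} (h : Eqv P Q) (x i : ℕ) :
    Eqv (addBox x i P) (addBox x i Q) := fun k => by
  rw [row_addBox, row_addBox, h k]

theorem adds_addBox (x i : ℕ) (P : Filling) :
    Adds i (fun k => (P.row k).length) fun k => ((addBox x i P).row k).length := fun k => by
  simp only [row_addBox]
  split_ifs <;> simp

theorem perm_addBox (x i : ℕ) (P : Filling) : (addBox x i P).flatten.Perm (x :: P.flatten) := by
  induction i generalizing P with
  | zero =>
    rcases P with _ | ⟨r, P⟩
    · simp [addBox]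
    · simp only [addBox, List.flatten_cons, List.append_assoc, List.singleton_append]
      exact List.perm_middle
  | succ i ih =>
    rcases P with _ | ⟨r, P⟩
    · simpa [addBox] using ih []
    · simp only [addBox, List.flatten_cons]
      exact ((ih P).append_left r).trans List.perm_middle

theorem row_delete (x : ℕ) (P : Filling) (k : ℕ) : (delete x P).row k = (P.row k).erase x := by
  induction P generalizing k with
  | nil => simp [row, delete]
  | cons r P ih =>
    rcases k with _ | k
    · simp [row, delete]
    · simpa [row, delete] using ih k

theorem delete_eqv {P Q : Filling} (h : Eqv P Q) (x : ℕ) : Eqv (delete x P) (delete x Q) :=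
  fun k => by rw [row_delete, row_delete, h k]

theorem delete_addBox {x : ℕ} {P : Filling} (hx : x ∉ P.flatten) (i : ℕ) :
    Eqv (delete x (addBox x i P)) P := fun k => by
  have h : x ∉ P.row k := fun h => hx (mem_flatten_iff.2 ⟨k, h⟩)
  rw [row_delete, row_addBox]
  split_ifs
  · rw [List.erase_append_right _ h]
    simp
  · exact List.erase_of_not_mem h

/-- A number exceeding all entries may go into any position that keeps the shape a diagram: it ends
its row and nothing stands below it. -/
theorem IsTableau.addBox {P : Filling} (hP : IsTableau P) {x : ℕ} (hx : ∀ y ∈ P.flatten, y < x)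
    {i : ℕ} (hi : ∀ k, k + 1 = i → (P.row i).length < (P.row k).length) :
    IsTableau (addBox x i P) := by
  have hlt : ∀ k, ∀ y ∈ P.row k, y < x := fun k y hy => hx y (mem_flatten_iff.2 ⟨k, hy⟩)
  constructor
  · intro k
    rw [row_addBox]
    split_ifs
    · simpa [List.pairwise_append] using ⟨hP.sorted k, fun a ha => (hlt k a ha).le⟩
    · exact hP.sorted k
  · intro k
    rw [row_addBox, row_addBox]
    by_cases h : k + 1 = i
    · rw [if_neg (by omega), if_pos h]
      intro j y hj
      rw [h] at hj
      have hlen := hi k h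
      rw [List.getElem?_append] at hj
      split_ifs at hj with h1
      · exact hP.dom k j y (by rw [h, hj])
      · have h2 : j = (P.row i).length := by
          have := (List.getElem?_eq_some_iff.1 hj).1
          simp only [List.length_singleton] at this
          omega
        obtain rfl : x = y := by simpa [h2] using hj
        rw [← h2] at hlen
        exact ⟨_, List.getElem?_eq_getElem hlen, hlt k _ (List.getElem_mem _)⟩
    · rw [if_neg h]
      split_ifs
      · exact (hP.dom k).of_prefix_left (List.prefix_append _ _)
      · exact hP.dom k

/-- The largest entry occupies a corner: anything to its right would equal it, which distinctness
forbids, and anything below it would be larger. -/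
theorem IsTableau.exists_addBox_delete {P : Filling} (hP : IsTableau P) (hd : P.flatten.Nodup)
    {x : ℕ} (hx : x ∈ P.flatten) (hmax : ∀ y ∈ P.flatten, y ≤ x) :
    ∃ i, Eqv (Filling.addBox x i (delete x P)) P ∧ IsTableau (delete x P) := by
  obtain ⟨i, hi⟩ := mem_flatten_iff.1 hx
  obtain ⟨A, B, hAB⟩ := List.append_of_mem hi
  have hle : ∀ k, ∀ y ∈ P.row k, y ≤ x := fun k y hy => hmax y (mem_flatten_iff.2 ⟨k, hy⟩)
  have hnd := row_nodup hd i
  have hs := hP.sorted i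
  rw [hAB] at hnd hs
  have hB : B = [] := by
    rcases B with _ | ⟨b, B⟩
    · rfl
    · have h1 := (pairwise_mid.1 hs).2.2.2.1 b (by simp)
      have h2 := hle i b (by rw [hAB]; simp)
      obtain rfl := le_antisymm h1 h2
      simp [List.nodup_append] at hnd
  subst hB
  have hA : x ∉ A := by
    intro h
    simp [List.nodup_append] at hnd
    exact hnd.2 x h rfl
  have hrow : ∀ k, (delete x P).row k = if k = i then A else P.row k := by
    intro k
    rw [row_delete]
    split_ifs with h
    · rw [h, hAB, List.erase_append_right _ hA]
      simp
    · exact List.erase_of_not_mem fun hk => h (row_unique hd hk hi)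
  have hpre : ∀ k, (delete x P).row k <+: P.row k := by
    intro k
    rw [hrow]
    split_ifs with h
    · rw [h, hAB]
      exact List.prefix_append _ _
    · exact List.prefix_rfl
  refine ⟨i, fun k => ?_, fun k => (hP.sorted k).sublist (hpre k).sublist, fun k => ?_⟩
  · rw [row_addBox, hrow]
    split_ifs with h
    · rw [h, hAB]
    · rfl
  · intro j y hj
    obtain ⟨z, hz, hzy⟩ := (hP.dom k).of_prefix_right (hpre (k + 1)) j y hj
    refine ⟨z, ?_, hzy⟩
    rw [hrow]
    split_ifs with h
    · rw [h, hAB, getElem?_mid] at hz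
      split_ifs at hz with h1 h2
      · exact hz
      · have h3 := hle (k + 1) y ((hpre (k + 1)).subset (List.mem_of_getElem? hj))
        simp at hz
        omega
      · simp at hz
    · exact hz

/-! ### Entries of the first column -/

/-- Climb the column of `y` to the first row, then go left to its first entry. -/
theorem IsTableau.exists_le {P : Filling} (hP : IsTableau P) {y : ℕ} (hy : y ∈ P.flatten) :
    ∃ z t, P.row 0 = z :: t ∧ z ≤ y := by
  obtain ⟨i, hi⟩ := mem_flatten_iff.1 hy
  induction i generalizing y with
  | zero =>
    have hs := hP.sorted 0
    rcases h : P.row 0 with _ | ⟨z, t⟩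
    · rw [h] at hi
      simp at hi
    · rw [h] at hi hs
      refine ⟨z, t, rfl, ?_⟩
      rcases List.mem_cons.1 hi with rfl | hi
      · exact le_rfl
      · exact (List.pairwise_cons.1 hs).1 y hi
  | succ i ih =>
    obtain ⟨j, hj⟩ := List.mem_iff_getElem?.1 hi
    obtain ⟨z, hz, hzy⟩ := hP.dom i j y hj
    have hz' := List.mem_of_getElem? hz
    obtain ⟨z', t, h, hle⟩ := ih (mem_flatten_iff.2 ⟨i, hz'⟩) hz'
    exact ⟨z', t, h, hle.trans hzy.le⟩

/-- The first row begins with an entry at most `y`, hence smaller than `x`, and `x` cannot replace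
it. -/
theorem IsTableau.exists_hasEntry_insert {P : Filling} (hP : IsTableau P) {x y : ℕ}
    (hy : y ∈ P.flatten) (hyx : y < x) : ∃ j ≠ 0, (Filling.insert x P).HasEntry 0 j x := by
  obtain ⟨z, t, h, hzy⟩ := hP.exists_le hy
  obtain ⟨A, B, C, hs, hb, hA, hC⟩ := bumpRow_shape x (P.row 0)
  refine ⟨A.length, ?_, ?_⟩
  · intro h0
    obtain rfl := List.eq_nil_of_length_eq_zero h0
    rw [hs, List.nil_append] at h
    rcases hC with ⟨rfl, -⟩ | ⟨w, hw, rfl⟩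
    · simp at h
    · simp at h
      omega
  · unfold HasEntry
    change ((Filling.insert x P).row 0)[A.length]? = some x
    rw [row_zero_insert, hb]
    simp

/-- The number `x` does not appear outside the first column of `P`. -/
def FirstColumn (x : ℕ) (P : Filling) : Prop := ∀ i j, P.HasEntry i j x → j = 0

theorem firstColumn_cons {x : ℕ} {r : List ℕ} {P : Filling} :
    FirstColumn x (r :: P) ↔ (∀ j, r[j]? = some x → j = 0) ∧ FirstColumn x P := by
  constructor
  · intro h
    exact ⟨fun j hj => h 0 j (by simpa [HasEntry] using hj),
      fun i j hj => h (i + 1) j (by simpa [HasEntry] using hj)⟩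
  · rintro ⟨h1, h2⟩ (_ | i) j hj
    · exact h1 j (by simpa [HasEntry] using hj)
    · exact h2 i j (by simpa [HasEntry] using hj)

theorem FirstColumn.congr {x : ℕ} {P Q : Filling} (h : FirstColumn x P) (hPQ : Eqv P Q) :
    FirstColumn x Q := fun i j hj => h i j (by
  change (P.row i)[j]? = _
  rw [hPQ i]
  exact hj)

theorem FirstColumn.of_addBox {x y i : ℕ} {P : Filling} (h : FirstColumn x (addBox y i P)) :
    FirstColumn x P := fun k j hj => h k j (by
  change ((addBox y i P).row k)[j]? = _
  change (P.row k)[j]? = _ at hj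
  rw [row_addBox]
  split_ifs
  · rw [List.getElem?_append_left (List.getElem?_eq_some_iff.1 hj).1, hj]
  · exact hj)

/-- The two claims need each other: inserting another number may bump `x`, which is then inserted
into the rows below, and inserting `x` bumps another number into them. -/
theorem IsTableau.firstColumn_insert {P : Filling} (hP : IsTableau P) {x : ℕ}
    (hx : FirstColumn x P) : (∀ y ≠ x, FirstColumn x (Filling.insert y P)) ∧
      ((∀ z t, P.row 0 = z :: t → x < z) → FirstColumn x (Filling.insert x P)) := by
  induction P with
  | nil =>
    refine ⟨fun y hy => ?_, fun _ => ?_⟩ <;> rw [insert_nil, firstColumn_cons] <;>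
      refine ⟨?_, hx⟩ <;> rintro (_ | j) <;> simp
  | cons r P ih =>
    rw [isTableau_cons] at hP
    rw [firstColumn_cons] at hx
    obtain ⟨h1, h2, h3⟩ := hP
    obtain ⟨ih1, ih2⟩ := ih h3 hx.2
    constructor
    · intro y hy
      rcases bumpRow_cases y r with hr | ⟨A, w, B, rfl, hA, hyw⟩
      · rw [insert_cons_of_forall_le hr, firstColumn_cons]
        refine ⟨fun j hj => ?_, hx.2⟩
        rw [getElem?_mid] at hj
        split_ifs at hj with h4 h5
        · exact hx.1 j hj
        · exact (hy (by simpa using hj)).elim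
        · simp at hj
      · rw [insert_cons_of_lt hA hyw, firstColumn_cons]
        constructor
        · intro j hj
          have := hx.1 j
          rw [getElem?_mid] at hj this
          split_ifs at hj this with h4 h5
          · exact this hj
          · exact (hy (by simpa using hj)).elim
          · exact this hj
        · by_cases hw : w = x
          · subst hw
            -- The bumped `x` stood in the first column, so by column strictness the row below
            -- begins with a larger entry, and the second claim applies there.
            refine ih2 fun z t hz => ?_
            have hA0 := hx.1 A.length (by simp)
            obtain ⟨u, hu, huz⟩ := h2 0 z (by rw [hz]; rfl)
            have : A = [] := List.eq_nil_of_length_eq_zero hA0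
            subst this
            simp at hu
            omega
          · exact ih1 w hw
    · intro hlt
      rcases r with _ | ⟨z, t⟩
      · rw [insert_cons_of_forall_le (by simp), firstColumn_cons]
        refine ⟨?_, hx.2⟩
        rintro (_ | j) <;> simp
      · have hxz : x < z := hlt z t (by simp [row])
        have := insert_cons_of_lt (A := []) (B := t) (by simp) hxz P
        simp only [List.nil_append] at this
        rw [this, firstColumn_cons]
        refine ⟨?_, ih1 z hxz.ne'⟩
        rintro (_ | j) hj
        · rfl
        · exact hx.1 (j + 1) (by simpa using hj)

end Filling

/-! ### Covering relations of Young diagrams as changes of row lengths. -/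

namespace YoungDiagram

open Filling (Adds)

theorem ext_rowLen {μ ν : YoungDiagram} (h : ∀ i, μ.rowLen i = ν.rowLen i) : μ = ν := by
  refine SetLike.ext ?_
  rintro ⟨i, j⟩
  rw [mem_iff_lt_rowLen, mem_iff_lt_rowLen, h]

theorem le_of_rowLen_le {μ ν : YoungDiagram} (h : ∀ i, μ.rowLen i ≤ ν.rowLen i) : μ ≤ ν := by
  rintro ⟨i, j⟩ hij
  rw [mem_iff_lt_rowLen] at hij ⊢
  exact hij.trans_le (h i)

theorem rowLen_le_of_le {μ ν : YoungDiagram} (h : μ ≤ ν) (i : ℕ) : μ.rowLen i ≤ ν.rowLen i := by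
  by_contra! hlt
  have := h (mem_iff_lt_rowLen.2 hlt)
  exact lt_irrefl _ (mem_iff_lt_rowLen.1 this)

theorem covBy_of_adds {μ ν : YoungDiagram} {i : ℕ} (h : Adds i μ.rowLen ν.rowLen) : μ ⋖ ν := by
  have hle : μ ≤ ν := le_of_rowLen_le fun k => by rw [h k]; omega
  refine ⟨lt_of_le_of_ne hle ?_, fun ρ h1 h2 => ?_⟩
  · rintro rfl
    have := h i
    simp at this
  · have hk : ∀ k ≠ i, μ.rowLen k = ρ.rowLen k ∧ ρ.rowLen k = ν.rowLen k := fun k hk => by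
      have a := rowLen_le_of_le h1.le k
      have b := rowLen_le_of_le h2.le k
      have c := h k
      rw [if_neg hk] at c
      omega
    have a := rowLen_le_of_le h1.le i
    have b := rowLen_le_of_le h2.le i
    have c := h i
    rw [if_pos rfl] at c
    rcases eq_or_lt_of_le a with a | a
    · refine h1.ne (ext_rowLen fun k => ?_)
      by_cases hki : k = i
      · rw [hki, a]
      · exact (hk k hki).1
    · refine h2.ne (ext_rowLen fun k => ?_)
      by_cases hki : k = i
      · rw [hki]; omega
      · exact (hk k hki).2

/-- A maximal cell of the difference is maximal in `ν`, so erasing it leaves a diagram between `μ`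
and `ν`; by the covering relation this diagram is `μ`. -/
theorem exists_adds_of_covBy {μ ν : YoungDiagram} (h : μ ⋖ ν) : ∃ i, Adds i μ.rowLen ν.rowLen := by
  have hne : (ν.cells \ μ.cells).Nonempty := by
    rw [Finset.sdiff_nonempty, cells_subset_iff]
    exact h.lt.not_ge
  obtain ⟨⟨i, j⟩, hc, hmax⟩ := Finset.exists_maximal hne
  rw [Finset.mem_sdiff, mem_cells, mem_cells] at hc
  have hmax' : ∀ c ∈ ν, (i, j) ≤ c → c = (i, j) := by
    intro c hcν hle
    refine le_antisymm (hmax ?_ hle) hle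
    change c ∈ ν.cells \ μ.cells
    rw [Finset.mem_sdiff, mem_cells, mem_cells]
    exact ⟨hcν, fun hcμ => hc.2 (μ.isLowerSet hle hcμ)⟩
  let ρ : YoungDiagram :=
    { cells := ν.cells.erase (i, j)
      isLowerSet := by
        intro a b hba ha
        simp only [Finset.coe_erase, Set.mem_sdiff, Set.mem_singleton_iff, Finset.mem_coe] at ha ⊢
        refine ⟨ν.isLowerSet hba ha.1, ?_⟩
        rintro rfl
        exact ha.2 (hmax' a ha.1 hba) }
  have hρ : ∀ c, c ∈ ρ ↔ c ≠ (i, j) ∧ c ∈ ν := fun c => Finset.mem_erase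
  have hμρ : μ ≤ ρ := by
    intro c hcμ
    exact (hρ c).2 ⟨fun hcc => hc.2 (hcc ▸ hcμ), h.le hcμ⟩
  have hρν : ρ < ν := lt_of_le_of_ne (fun c hcρ => ((hρ c).1 hcρ).2) fun he =>
    ((hρ (i, j)).1 (he ▸ hc.1)).1 rfl
  have heq : μ = ρ := by
    by_contra hne
    exact h.2 (lt_of_le_of_ne hμρ hne) hρν
  have hmem : ∀ a b, b < μ.rowLen a ↔ (a, b) ≠ (i, j) ∧ b < ν.rowLen a := fun a b => by
    rw [← mem_iff_lt_rowLen, ← mem_iff_lt_rowLen, heq, hρ]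
  refine ⟨i, fun k => ?_⟩
  by_cases hk : k = i
  · subst hk
    have h1 : j < ν.rowLen k := mem_iff_lt_rowLen.1 hc.1
    have h2 : ν.rowLen k ≤ j + 1 := by
      by_contra! hlt
      have := hmax' (k, j + 1) (mem_iff_lt_rowLen.2 hlt) ⟨le_rfl, Nat.le_succ j⟩
      simp at this
    have h3 : μ.rowLen k ≤ j := by
      by_contra! hlt
      exact ((hmem k j).1 hlt).1 rfl
    have h4 : j ≤ μ.rowLen k := by
      rcases j with _ | j
      · exact Nat.zero_le _
      · exact (hmem k j).2 ⟨by simp, by omega⟩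
    rw [if_pos rfl]
    omega
  · rw [if_neg hk, add_zero]
    have hlt : ∀ b, b < μ.rowLen k ↔ b < ν.rowLen k := fun b => by
      rw [hmem]
      exact and_iff_right fun he => hk (Prod.ext_iff.1 he).1
    have a := hlt (μ.rowLen k)
    have b := hlt (ν.rowLen k)
    omega

/-- The supremum in `changedRow` is taken over a single box, so it is the row of that box. -/
theorem sup_symmDiff_of_adds {μ ν : YoungDiagram} {i : ℕ} (h : Adds i μ.rowLen ν.rowLen) :
    (symmDiff μ.cells ν.cells).sup Prod.fst = i := by
  have : symmDiff μ.cells ν.cells = {(i, μ.rowLen i)} := by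
    ext ⟨a, b⟩
    rw [Finset.mem_symmDiff, mem_cells, mem_cells, mem_iff_lt_rowLen, mem_iff_lt_rowLen, h a,
      Finset.mem_singleton, Prod.mk.injEq]
    by_cases ha : a = i
    · subst ha
      rw [if_pos rfl]
      simp only [true_and]
      omega
    · rw [if_neg ha]
      simp [ha]
  rw [this, Finset.sup_singleton]

end YoungDiagram

/-! ### Shapes of fillings as Young diagrams. -/

namespace Filling

/-- The row lengths of `P` are those of the Young diagram `μ`. -/
def HasShape (P : Filling) (μ : YoungDiagram) : Prop := ∀ i, (P.row i).length = μ.rowLen i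

theorem HasShape.coe_eq_boxes {P : Filling} {μ : YoungDiagram} (h : P.HasShape μ) :
    (μ : Set (ℕ × ℕ)) = P.boxes := by
  ext ⟨i, j⟩
  rw [SetLike.mem_coe, YoungDiagram.mem_iff_lt_rowLen, ← h i]
  rfl

theorem hasShape_of_coe_eq_boxes {P : Filling} {μ : YoungDiagram}
    (h : (μ : Set (ℕ × ℕ)) = P.boxes) : P.HasShape μ := by
  intro i
  have hlt : ∀ j, j < μ.rowLen i ↔ j < (P.row i).length := fun j => by
    rw [← YoungDiagram.mem_iff_lt_rowLen, ← SetLike.mem_coe, h]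
    rfl
  have a := hlt (μ.rowLen i)
  have b := hlt (P.row i).length
  omega

theorem HasShape.congr {P Q : Filling} {μ : YoungDiagram} (h : P.HasShape μ) (hPQ : Eqv P Q) :
    Q.HasShape μ := fun i => hPQ i ▸ h i

theorem HasShape.unique {P : Filling} {μ ν : YoungDiagram} (h : P.HasShape μ)
    (h' : P.HasShape ν) : μ = ν :=
  YoungDiagram.ext_rowLen fun i => (h i).symm.trans (h' i)

theorem HasShape.adds_iff {P Q : Filling} {μ ν : YoungDiagram} (hP : P.HasShape μ)
    (hQ : Q.HasShape ν) {i : ℕ} : Adds i (fun k => (P.row k).length) (fun k => (Q.row k).length) ↔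
      Adds i μ.rowLen ν.rowLen := by
  simp only [Adds, hP _, hQ _]

theorem hasShape_bot_iff {P : Filling} : P.HasShape ⊥ ↔ Eqv [] P := by
  have h0 : ∀ i, (⊥ : YoungDiagram).rowLen i = 0 := fun i => by
    by_contra h
    exact YoungDiagram.notMem_bot _ (YoungDiagram.mem_iff_lt_rowLen.2 (Nat.pos_of_ne_zero h))
  refine forall_congr' fun i => ?_
  rw [h0, row_nil, List.length_eq_zero_iff, eq_comm]

/-- Column domination makes the row lengths weakly decreasing; zero lengths from trailing empty rows
do no harm in `ofRowLens`. -/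
theorem IsTableau.exists_hasShape {P : Filling} (hP : IsTableau P) :
    ∃ μ : YoungDiagram, P.HasShape μ := by
  have hanti : Antitone fun i => (P.row i).length := antitone_nat_of_succ_le fun i =>
    (hP.dom i).length_le
  have hw : (P.map List.length).SortedGE := by
    intro i j hij
    have := hanti (show (i : ℕ) ≤ j from hij)
    have hi : (i : ℕ) < P.length := by simpa using i.2
    have hj : (j : ℕ) < P.length := by simpa using j.2
    simpa [row, hi, hj] using this
  refine ⟨YoungDiagram.ofRowLens _ hw, hasShape_of_coe_eq_boxes ?_⟩
  ext ⟨i, j⟩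
  rw [SetLike.mem_coe, YoungDiagram.mem_ofRowLens]
  change _ ↔ j < (P.row i).length
  by_cases h : i < P.length
  · simp [row, h]
  · simp [row, h]

end Filling

open Classical in
/-- The number of indices weakly after `k` at which `D` holds. -/
def countFrom {m : ℕ} (D : Fin m → Prop) (k : Fin m) : ℕ :=
  (Finset.univ.filter fun k' => k ≤ k' ∧ D k').card

open Classical in
theorem countFrom_lt {m : ℕ} {D : Fin m → Prop} {k k' : Fin m} (h : k < k') (hk : D k) :
    countFrom D k' < countFrom D k := by
  refine Finset.card_lt_card ⟨fun j hj => ?_, fun hsub => ?_⟩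
  · rw [Finset.mem_filter] at hj ⊢
    exact ⟨hj.1, h.le.trans hj.2.1, hj.2.2⟩
  · have := hsub (Finset.mem_filter.2 ⟨Finset.mem_univ k, le_rfl, hk⟩)
    rw [Finset.mem_filter] at this
    exact h.not_ge this.2.1

theorem countFrom_inj {m : ℕ} {D : Fin m → Prop} {k k' : Fin m} (hk : D k) (hk' : D k')
    (h : countFrom D k = countFrom D k') : k = k' := by
  rcases lt_trichotomy k k' with hlt | rfl | hlt
  · exact absurd h (countFrom_lt hlt hk).ne'
  · rfl
  · exact absurd h (countFrom_lt hlt hk').ne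

open Filling

/-! ### Labels of a matching and the fillings read from it. -/

namespace CompleteMatching

variable {n : ℕ} (M : CompleteMatching n)

theorem exists_adj (v : Fin (2 * n)) : ∃ w, M.1.Adj v w :=
  (SimpleGraph.Subgraph.isPerfectMatching_iff.1 M.2 v).exists

variable {M}

theorem adj_unique {v w w' : Fin (2 * n)} (h : M.1.Adj v w) (h' : M.1.Adj v w') : w = w' :=
  (SimpleGraph.Subgraph.isPerfectMatching_iff.1 M.2 v).unique h h'

theorem mem_arcs {p : Fin (2 * n) × Fin (2 * n)} : p ∈ M.arcs ↔ p.1 < p.2 ∧ M.1.Adj p.1 p.2 := by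
  simp [arcs]

theorem not_isStart_snd {p : Fin (2 * n) × Fin (2 * n)} (hp : p ∈ M.arcs) : ¬ M.IsStart p.2 := by
  rintro ⟨w, hw, h⟩
  rw [mem_arcs] at hp
  obtain rfl := adj_unique h hp.2.symm
  exact lt_asymm hw hp.1

theorem isStart_fst {p : Fin (2 * n) × Fin (2 * n)} (hp : p ∈ M.arcs) : M.IsStart p.1 :=
  ⟨p.2, mem_arcs.1 hp⟩

theorem exists_arc_of_not_isStart {v : Fin (2 * n)} (hv : ¬ M.IsStart v) :
    ∃ u, (u, v) ∈ M.arcs := by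
  obtain ⟨w, hw⟩ := M.exists_adj v
  refine ⟨w, mem_arcs.2 ⟨?_, hw.symm⟩⟩
  rcases lt_trichotomy w v with h | rfl | h
  · exact h
  · exact (hw.ne rfl).elim
  · exact (hv ⟨w, h, hw⟩).elim

theorem exists_arc_of_isStart {v : Fin (2 * n)} (hv : M.IsStart v) :
    ∃ w, (v, w) ∈ M.arcs := hv.imp fun _ h => mem_arcs.2 h

theorem arc_eq_of_snd {p q : Fin (2 * n) × Fin (2 * n)} (hp : p ∈ M.arcs) (hq : q ∈ M.arcs)
    (h : p.2 = q.2) : p = q := by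
  rw [mem_arcs] at hp hq
  exact Prod.ext (adj_unique hp.2.symm (h ▸ hq.2.symm)) h

open Classical in
-- The definition of `label` compares right ends both with the vertex and with its partner, so
-- either end counts the arcs ending weakly after the right end of `p`.
theorem label_fst {p : Fin (2 * n) × Fin (2 * n)} (hp : p ∈ M.arcs) :
    M.label p.1 = M.label p.2 := by
  have hp' := mem_arcs.1 hp
  refine congrArg Finset.card (Finset.filter_congr fun q _ => ?_)
  constructor
  · rintro ⟨-, h⟩
    have h2 := h _ hp'.2
    exact ⟨h2, fun w hw => adj_unique hp'.2.symm hw ▸ (hp'.1.le.trans h2)⟩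
  · rintro ⟨h, -⟩
    exact ⟨hp'.1.le.trans h, fun w hw => adj_unique hp'.2 hw ▸ h⟩

open Classical in
-- Arcs correspond to their right ends. The predicate `D` is left free so that it can also be
-- `IsDown` of an oscillating tableau.
theorem label_eq_countFrom {D : Fin (2 * n) → Prop} (hD : ∀ k, D k ↔ ¬ M.IsStart k)
    {v : Fin (2 * n)} (hv : ¬ M.IsStart v) : M.label v = countFrom D v := by
  obtain ⟨u, hu⟩ := exists_arc_of_not_isStart hv
  rw [mem_arcs] at hu
  refine Finset.card_bij (fun p _ => p.2) ?_ ?_ ?_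
  · intro p hp
    have hp := Finset.mem_filter.1 hp
    exact Finset.mem_filter.2 ⟨Finset.mem_univ _, hp.2.1, (hD _).2 (not_isStart_snd hp.1)⟩
  · intro p hp q hq h
    exact arc_eq_of_snd (Finset.mem_filter.1 hp).1 (Finset.mem_filter.1 hq).1 h
  · intro b hb
    have hb := Finset.mem_filter.1 hb
    obtain ⟨a, ha⟩ := exists_arc_of_not_isStart ((hD b).1 hb.2.2)
    refine ⟨(a, b), Finset.mem_filter.2 ⟨ha, hb.2.1, fun w hw => ?_⟩, rfl⟩
    rw [← adj_unique hu.2.symm hw]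
    exact hu.1.le.trans hb.2.1

theorem label_of_not_isStart {v : Fin (2 * n)} (hv : ¬ M.IsStart v) :
    M.label v = countFrom (fun k => ¬ M.IsStart k) v := label_eq_countFrom (fun _ => Iff.rfl) hv

theorem label_lt {p q : Fin (2 * n) × Fin (2 * n)} (hp : p ∈ M.arcs) (hq : q ∈ M.arcs)
    (h : p.2 < q.2) : M.label q.2 < M.label p.2 := by
  rw [label_of_not_isStart (not_isStart_snd hp), label_of_not_isStart (not_isStart_snd hq)]
  exact countFrom_lt h (not_isStart_snd hp)

theorem label_inj {p q : Fin (2 * n) × Fin (2 * n)} (hp : p ∈ M.arcs) (hq : q ∈ M.arcs)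
    (h : M.label p.2 = M.label q.2) : p = q := by
  rw [label_of_not_isStart (not_isStart_snd hp), label_of_not_isStart (not_isStart_snd hq)] at h
  exact arc_eq_of_snd hp hq (countFrom_inj (not_isStart_snd hp) (not_isStart_snd hq) h)

theorem exists_arc (v : Fin (2 * n)) : ∃ p ∈ M.arcs, v = p.1 ∨ v = p.2 := by
  by_cases hv : M.IsStart v
  · obtain ⟨w, hw⟩ := exists_arc_of_isStart hv
    exact ⟨_, hw, Or.inl rfl⟩
  · obtain ⟨w, hw⟩ := exists_arc_of_not_isStart hv
    exact ⟨_, hw, Or.inr rfl⟩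

/-- Recovers a matching from its labels, in the very form in which `toMatching` defines adjacency.
-/
theorem adj_iff {v w : Fin (2 * n)} : M.1.Adj v w ↔ v ≠ w ∧ M.label v = M.label w := by
  obtain ⟨p, hp, hv⟩ := M.exists_arc v
  obtain ⟨q, hq, hw⟩ := M.exists_arc w
  constructor
  · intro h
    refine ⟨h.ne, ?_⟩
    have hp' := mem_arcs.1 hp
    rcases hv with rfl | rfl
    · rw [adj_unique h hp'.2, label_fst hp]
    · rw [adj_unique h hp'.2.symm, label_fst hp]
  · rintro ⟨hne, h⟩
    have hv' : M.label v = M.label p.2 := by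
      rcases hv with rfl | rfl
      · exact label_fst hp
      · rfl
    have hw' : M.label w = M.label q.2 := by
      rcases hw with rfl | rfl
      · exact label_fst hq
      · rfl
    obtain rfl := label_inj hp hq (hv' ▸ hw' ▸ h)
    have hp' := mem_arcs.1 hp
    rcases hv with rfl | rfl <;> rcases hw with rfl | rfl
    · exact (hne rfl).elim
    · exact hp'.2
    · exact hp'.2.symm
    · exact (hne rfl).elim

variable (M) in
theorem filling_zero : M.filling 0 = [] := rfl

theorem filling_succ_of_isStart {v : Fin (2 * n)} (hv : M.IsStart v) :
    M.filling v.succ = (M.filling v.castSucc).insert (M.label v) := by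
  rw [filling, Fin.induction_succ, if_pos hv]

theorem filling_succ_of_not_isStart {v : Fin (2 * n)} (hv : ¬ M.IsStart v) :
    M.filling v.succ = (M.filling v.castSucc).delete (M.label v) := by
  rw [filling, Fin.induction_succ, if_neg hv]

variable (M) in
/-- The entries of `P` are the labels of the edges which are open before the `k`-th vertex. -/
def OpenLabels (k : Fin (2 * n + 1)) (P : Filling) : Prop :=
  ∀ x, x ∈ P.flatten ↔
    ∃ p ∈ M.arcs, p.1.castSucc < k ∧ k ≤ p.2.castSucc ∧ M.label p.2 = x

theorem OpenLabels.label_notMem {v : Fin (2 * n)} {P : Filling}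
    (hP : M.OpenLabels v.castSucc P) (hv : M.IsStart v) : M.label v ∉ P.flatten := by
  obtain ⟨w, hw⟩ := exists_arc_of_isStart hv
  rw [hP]
  rintro ⟨p, hp, h1, -, h3⟩
  rw [label_fst hw] at h3
  obtain rfl := label_inj hp hw h3
  exact lt_irrefl _ h1

theorem OpenLabels.label_mem {v : Fin (2 * n)} {P : Filling}
    (hP : M.OpenLabels v.castSucc P) (hv : ¬ M.IsStart v) : M.label v ∈ P.flatten := by
  obtain ⟨u, hu⟩ := exists_arc_of_not_isStart hv
  exact (hP _).2 ⟨(u, v), hu, (mem_arcs.1 hu).1, le_rfl, rfl⟩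

/-- Every open edge ends at `v` or later, and later right ends have smaller labels. Hence the entry
to be deleted is always the largest. -/
theorem OpenLabels.le_label {v : Fin (2 * n)} {P : Filling} (hP : M.OpenLabels v.castSucc P)
    (hv : ¬ M.IsStart v) {x : ℕ} (hx : x ∈ P.flatten) : x ≤ M.label v := by
  obtain ⟨u, hu⟩ := exists_arc_of_not_isStart hv
  obtain ⟨p, hp, -, h2, rfl⟩ := (hP x).1 hx
  rw [Fin.castSucc_le_castSucc_iff] at h2
  rcases eq_or_lt_of_le h2 with rfl | h2
  · rfl
  · exact (label_lt hu hp h2).le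

/-- The three claims are proved together: that a deletion leaves a tableau depends on the entries
being distinct and being the labels of the open edges. -/
theorem filling_spec (k : Fin (2 * n + 1)) :
    IsTableau (M.filling k) ∧ (M.filling k).flatten.Nodup ∧ M.OpenLabels k (M.filling k) := by
  induction k using Fin.induction with
  | zero =>
    refine ⟨isTableau_nil, by simp [filling_zero], fun x => ?_⟩
    simp [filling_zero]
  | succ v ih =>
    obtain ⟨h1, h2, h3⟩ := ih
    by_cases hv : M.IsStart v
    · have hperm := perm_insert (M.label v) (M.filling v.castSucc)
      rw [filling_succ_of_isStart hv]
      refine ⟨h1.insert _, ?_, fun x => ?_⟩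
      · rw [hperm.nodup_iff, List.nodup_cons]
        exact ⟨h3.label_notMem hv, h2⟩
      · rw [hperm.mem_iff, List.mem_cons, h3]
        obtain ⟨w, hw⟩ := exists_arc_of_isStart hv
        simp only [Fin.castSucc_lt_castSucc_iff, Fin.castSucc_le_castSucc_iff,
          Fin.castSucc_lt_succ_iff, Fin.succ_le_castSucc_iff]
        constructor
        · rintro (rfl | ⟨p, hp, h4, h5, rfl⟩)
          · exact ⟨_, hw, le_rfl, (mem_arcs.1 hw).1, (label_fst hw).symm⟩
          · refine ⟨p, hp, h4.le, lt_of_le_of_ne h5 ?_, rfl⟩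
            rintro rfl
            exact not_isStart_snd hp hv
        · rintro ⟨p, hp, h4, h5, rfl⟩
          rcases eq_or_lt_of_le h4 with rfl | h4
          · exact Or.inl (label_fst hp).symm
          · exact Or.inr ⟨p, hp, h4, h5.le, rfl⟩
    · obtain ⟨i, h4, h5⟩ := h1.exists_addBox_delete h2 (h3.label_mem hv)
        fun y hy => h3.le_label hv hy
      rw [filling_succ_of_not_isStart hv]
      have hperm := perm_addBox (M.label v) i (delete (M.label v) (M.filling v.castSucc))
      rw [h4.flatten_eq] at hperm
      have hnd := hperm.nodup_iff.1 h2
      rw [List.nodup_cons] at hnd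
      refine ⟨h5, hnd.2, fun x => ?_⟩
      have hx : x ∈ (delete (M.label v) (M.filling v.castSucc)).flatten ↔
          x ≠ M.label v ∧ x ∈ (M.filling v.castSucc).flatten := by
        rw [hperm.mem_iff, List.mem_cons]
        constructor
        · exact fun h => ⟨fun he => hnd.1 (he ▸ h), Or.inr h⟩
        · rintro ⟨h6, h7 | h7⟩
          · exact (h6 h7).elim
          · exact h7
      rw [hx, h3]
      simp only [Fin.castSucc_lt_castSucc_iff, Fin.castSucc_le_castSucc_iff,
          Fin.castSucc_lt_succ_iff, Fin.succ_le_castSucc_iff]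
      constructor
      · rintro ⟨h6, p, hp, h7, h8, rfl⟩
        refine ⟨p, hp, h7.le, lt_of_le_of_ne h8 ?_, rfl⟩
        rintro rfl
        exact h6 rfl
      · rintro ⟨p, hp, h7, h8, rfl⟩
        obtain ⟨u, hu⟩ := exists_arc_of_not_isStart hv
        refine ⟨(label_lt hu hp h8).ne, p, hp, lt_of_le_of_ne h7 ?_, h8.le, rfl⟩
        rintro rfl
        exact hv (isStart_fst hp)

theorem exists_addBox_filling_succ {v : Fin (2 * n)} (hv : ¬ M.IsStart v) :
    ∃ i, Eqv (addBox (M.label v) i (M.filling v.succ)) (M.filling v.castSucc) := by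
  obtain ⟨h1, h2, h3⟩ := M.filling_spec v.castSucc
  obtain ⟨i, h4, -⟩ := h1.exists_addBox_delete h2 (h3.label_mem hv) fun y hy => h3.le_label hv hy
  rw [← filling_succ_of_not_isStart hv] at h4
  exact ⟨i, h4⟩

variable (M) in
theorem filling_last : Eqv [] (M.filling (Fin.last (2 * n))) := by
  have h : (M.filling (Fin.last (2 * n))).flatten = [] := by
    rw [List.eq_nil_iff_forall_not_mem]
    intro x hx
    obtain ⟨p, -, -, h, -⟩ := ((M.filling_spec _).2.2 x).1 hx
    exact (Fin.castSucc_lt_last p.2).not_ge h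
  intro i
  rw [row_nil, eq_comm, List.eq_nil_iff_forall_not_mem]
  intro x hx
  have := mem_flatten_iff.2 ⟨i, hx⟩
  simp [h] at this

/-! ### The oscillating tableau of a matching -/

variable (M) in
/-- The shape of the `k`-th filling of a matching. -/
def shape (k : Fin (2 * n + 1)) : YoungDiagram :=
  (M.filling_spec k).1.exists_hasShape.choose

variable (M) in
theorem hasShape (k : Fin (2 * n + 1)) : (M.filling k).HasShape (M.shape k) :=
  (M.filling_spec k).1.exists_hasShape.choose_spec

variable (M) in
/-- The oscillating tableau of a matching. -/
def toTableau : OscillatingTableau (2 * n) where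
  shape := M.shape
  first := (M.hasShape 0).unique (hasShape_bot_iff.2 (Eqv.refl _))
  last := (M.hasShape _).unique (hasShape_bot_iff.2 M.filling_last)
  step v := by
    by_cases hv : M.IsStart v
    · left
      obtain ⟨i, h, -⟩ := (M.filling_spec v.castSucc).1.exists_unbump_insert (M.label v)
      rw [← filling_succ_of_isStart hv, (M.hasShape _).adds_iff (M.hasShape _)] at h
      exact YoungDiagram.covBy_of_adds h
    · right
      obtain ⟨i, h⟩ := exists_addBox_filling_succ hv
      have h' := adds_addBox (M.label v) i (M.filling v.succ)
      rw [(M.hasShape _).adds_iff ((M.hasShape _).congr h.symm)] at h'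
      exact YoungDiagram.covBy_of_adds h'

end CompleteMatching

/-! ### Fillings of an oscillating tableau and the numbers that enter and leave them. -/

namespace OscillatingTableau

variable {m : ℕ} (T : OscillatingTableau m)

variable {T} in
theorem covBy_of_not_isDown {v : Fin m} (hv : ¬ T.IsDown v) :
    T.shape v.castSucc ⋖ T.shape v.succ := (T.step v).resolve_right hv

variable {T} in
theorem not_isDown_of_covBy {v : Fin m} (hv : T.shape v.castSucc ⋖ T.shape v.succ) :
    ¬ T.IsDown v := fun h => lt_asymm hv.lt h.lt

theorem filling_last : T.filling (Fin.last m) = [] := by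
  rw [filling, Fin.reverseInduction_last]

/-- The number which is put into the filling or leaves it at step `v`. -/
def stepLabel (v : Fin m) : ℕ :=
  open Classical in
  if T.IsDown v then T.label v else ((T.filling v.succ).unbump (T.changedRow v)).2

variable {T}

theorem filling_castSucc_of_isDown {v : Fin m} (hv : T.IsDown v) :
    T.filling v.castSucc = (T.filling v.succ).addBox (T.label v) (T.changedRow v) := by
  rw [filling, Fin.reverseInduction_castSucc, if_pos hv]

theorem filling_castSucc_of_not_isDown {v : Fin m} (hv : ¬ T.IsDown v) :
    T.filling v.castSucc = ((T.filling v.succ).unbump (T.changedRow v)).1 := by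
  rw [filling, Fin.reverseInduction_castSucc, if_neg hv]

theorem stepLabel_of_isDown {v : Fin m} (hv : T.IsDown v) : T.stepLabel v = T.label v :=
  if_pos hv

theorem stepLabel_of_not_isDown {v : Fin m} (hv : ¬ T.IsDown v) :
    T.stepLabel v = ((T.filling v.succ).unbump (T.changedRow v)).2 := if_neg hv

theorem changedRow_of_adds {v : Fin m} {i : ℕ}
    (h : Adds i (T.shape v.castSucc).rowLen (T.shape v.succ).rowLen) : T.changedRow v = i :=
  YoungDiagram.sup_symmDiff_of_adds h

theorem changedRow_of_adds' {v : Fin m} {i : ℕ}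
    (h : Adds i (T.shape v.succ).rowLen (T.shape v.castSucc).rowLen) : T.changedRow v = i := by
  rw [changedRow, symmDiff_comm]
  exact YoungDiagram.sup_symmDiff_of_adds h

theorem adds_changedRow {v : Fin m} (hv : ¬ T.IsDown v) :
    Adds (T.changedRow v) (T.shape v.castSucc).rowLen (T.shape v.succ).rowLen := by
  obtain ⟨i, h⟩ := YoungDiagram.exists_adds_of_covBy (covBy_of_not_isDown hv)
  rwa [changedRow_of_adds h]

theorem adds_changedRow' {v : Fin m} (hv : T.IsDown v) :
    Adds (T.changedRow v) (T.shape v.succ).rowLen (T.shape v.castSucc).rowLen := by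
  obtain ⟨i, h⟩ := YoungDiagram.exists_adds_of_covBy hv
  rwa [changedRow_of_adds' h]

theorem hasShape_of_adds {P Q : Filling} {μ ν : YoungDiagram} {i : ℕ} (hP : P.HasShape μ)
    (h : Adds i (fun k => (P.row k).length) fun k => (Q.row k).length)
    (h' : Adds i μ.rowLen ν.rowLen) : Q.HasShape ν := fun k => by
  rw [h' k, ← hP k]
  exact h k

theorem hasShape_of_adds' {P Q : Filling} {μ ν : YoungDiagram} {i : ℕ} (hQ : Q.HasShape ν)
    (h : Adds i (fun k => (P.row k).length) fun k => (Q.row k).length)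
    (h' : Adds i μ.rowLen ν.rowLen) : P.HasShape μ := fun k => by
  have h1 := h' k
  have h2 := hQ k
  have h3 : (Q.row k).length = (P.row k).length + if k = i then 1 else 0 := h k
  omega

theorem insert_unbump_of_adds {P : Filling} (hP : IsTableau P) {μ ν : YoungDiagram} {i : ℕ}
    (hs : P.HasShape ν) (h : Adds i μ.rowLen ν.rowLen) :
    IsTableau (unbump i P).1 ∧ (unbump i P).1.HasShape μ ∧
      Eqv (Filling.insert (unbump i P).2 (unbump i P).1) P := by
  obtain ⟨h1, h2, h3⟩ := hP.insert_unbump (i := i) (by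
    have a := h i
    have b := h (i + 1)
    have c := μ.rowLen_anti i (i + 1) (Nat.le_succ i)
    rw [if_pos rfl] at a
    rw [if_neg (by omega)] at b
    rw [hs, hs]
    omega)
  exact ⟨h1, hasShape_of_adds' hs h3 h, h2⟩

end OscillatingTableau

namespace OscillatingTableau

variable {m : ℕ} {T : OscillatingTableau m}

variable (T) in
-- The last clause drives the induction: the entries are smaller than every number still to be put
-- in further left, so each new box receives the largest entry.
theorem filling_spec (k : Fin (m + 1)) :
    IsTableau (T.filling k) ∧ (T.filling k).HasShape (T.shape k) ∧ (T.filling k).flatten.Nodup ∧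
      ∀ x ∈ (T.filling k).flatten, ∀ v : Fin m, v.castSucc < k → T.IsDown v → x < T.label v := by
  induction k using Fin.reverseInduction with
  | last =>
    rw [filling_last, T.last]
    exact ⟨isTableau_nil, hasShape_bot_iff.2 (Eqv.refl _), by simp, by simp⟩
  | cast v ih =>
    obtain ⟨h1, h2, h3, h4⟩ := ih
    by_cases hv : T.IsDown v
    · have hlt : ∀ x ∈ (T.filling v.succ).flatten, x < T.label v := fun x hx =>
        h4 x hx v Fin.castSucc_lt_succ hv
      have hadd := adds_changedRow' hv
      have hperm := perm_addBox (T.label v) (T.changedRow v) (T.filling v.succ)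
      rw [filling_castSucc_of_isDown hv]
      refine ⟨h1.addBox hlt fun k hk => ?_, hasShape_of_adds h2 (adds_addBox _ _ _) hadd, ?_, ?_⟩
      · rw [h2, h2]
        have a := hadd (T.changedRow v)
        have b := hadd k
        have c := (T.shape v.castSucc).rowLen_anti k (T.changedRow v) (by omega)
        rw [if_pos rfl] at a
        rw [if_neg (by omega)] at b
        omega
      · rw [hperm.nodup_iff, List.nodup_cons]
        exact ⟨fun h => lt_irrefl _ (hlt _ h), h3⟩
      · intro x hx u hu hd
        rw [hperm.mem_iff, List.mem_cons] at hx
        rw [Fin.castSucc_lt_castSucc_iff] at hu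
        rcases hx with rfl | hx
        · exact countFrom_lt hu hd
        · exact h4 x hx u (Fin.castSucc_lt_succ_iff.2 hu.le) hd
    · obtain ⟨h5, h6, h7⟩ := insert_unbump_of_adds h1 h2 (adds_changedRow hv)
      have hperm := perm_insert ((T.filling v.succ).unbump (T.changedRow v)).2
        ((T.filling v.succ).unbump (T.changedRow v)).1
      rw [h7.flatten_eq] at hperm
      rw [filling_castSucc_of_not_isDown hv]
      rw [hperm.nodup_iff, List.nodup_cons] at h3
      refine ⟨h5, h6, h3.2, fun x hx u hu hd => ?_⟩
      exact h4 x (hperm.mem_iff.2 (List.mem_cons_of_mem _ hx)) u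
        (Fin.castSucc_lt_succ_iff.2 (Fin.castSucc_lt_castSucc_iff.1 hu).le) hd

theorem label_notMem_filling_succ {v : Fin m} (hv : T.IsDown v) :
    T.label v ∉ (T.filling v.succ).flatten := fun h =>
  lt_irrefl _ ((T.filling_spec v.succ).2.2.2 _ h v Fin.castSucc_lt_succ hv)

theorem insert_stepLabel_eqv {v : Fin m} (hv : ¬ T.IsDown v) :
    Eqv ((T.filling v.castSucc).insert (T.stepLabel v)) (T.filling v.succ) := by
  obtain ⟨h1, h2, -⟩ := T.filling_spec v.succ
  rw [filling_castSucc_of_not_isDown hv, stepLabel_of_not_isDown hv]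
  exact (insert_unbump_of_adds h1 h2 (adds_changedRow hv)).2.2

theorem perm_of_isDown {v : Fin m} (hv : T.IsDown v) :
    (T.filling v.castSucc).flatten.Perm (T.stepLabel v :: (T.filling v.succ).flatten) := by
  rw [filling_castSucc_of_isDown hv, stepLabel_of_isDown hv]
  exact perm_addBox _ _ _

theorem perm_of_not_isDown {v : Fin m} (hv : ¬ T.IsDown v) :
    (T.filling v.succ).flatten.Perm (T.stepLabel v :: (T.filling v.castSucc).flatten) := by
  rw [← (insert_stepLabel_eqv hv).flatten_eq]
  exact perm_insert _ _

/-- A property which holds at `a` but not at `b` is lost at some step in between. -/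
theorem exists_step {p : Fin (m + 1) → Prop} {a b : Fin (m + 1)} (hab : a ≤ b) (ha : p a)
    (hb : ¬ p b) : ∃ v : Fin m, a ≤ v.castSucc ∧ v.succ ≤ b ∧ p v.castSucc ∧ ¬ p v.succ := by
  by_contra! h
  have key : ∀ k, a ≤ k → k ≤ b → p k := by
    intro k
    induction k using Fin.induction with
    | zero =>
      intro h1 _
      rwa [← Fin.le_zero_iff.1 h1]
    | succ v ih =>
      intro h1 h2
      rcases eq_or_lt_of_le h1 with rfl | h1
      · exact ha
      · have h1' : a ≤ v.castSucc := Fin.le_castSucc_iff.2 h1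
        exact h v h1' h2 (ih h1' (Fin.castSucc_lt_succ.le.trans h2))
  exact hb (key b hab le_rfl)

theorem flatten_filling_zero : (T.filling 0).flatten = [] := by
  have h := (T.filling_spec 0).2.1
  rw [T.first, hasShape_bot_iff] at h
  exact h.flatten_nil

theorem stepLabel_mem_of_isDown {v : Fin m} (hv : T.IsDown v) :
    T.stepLabel v ∈ (T.filling v.castSucc).flatten :=
  (perm_of_isDown hv).mem_iff.2 List.mem_cons_self

theorem stepLabel_mem_of_not_isDown {v : Fin m} (hv : ¬ T.IsDown v) :
    T.stepLabel v ∈ (T.filling v.succ).flatten :=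
  (perm_of_not_isDown hv).mem_iff.2 List.mem_cons_self

theorem stepLabel_notMem_of_not_isDown {v : Fin m} (hv : ¬ T.IsDown v) :
    T.stepLabel v ∉ (T.filling v.castSucc).flatten :=
  (List.nodup_cons.1 ((perm_of_not_isDown hv).nodup_iff.1 (T.filling_spec v.succ).2.2.1)).1

theorem exists_isDown_of_lost {x : ℕ} {a b : Fin (m + 1)} (hab : a ≤ b)
    (ha : x ∈ (T.filling a).flatten) (hb : x ∉ (T.filling b).flatten) :
    ∃ v : Fin m, a ≤ v.castSucc ∧ v.succ ≤ b ∧ T.IsDown v ∧ T.stepLabel v = x := by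
  obtain ⟨v, h1, h2, h3, h4⟩ := exists_step (p := fun k => x ∈ (T.filling k).flatten) hab ha hb
  have hv : T.IsDown v := by
    by_contra hv
    exact h4 ((perm_of_not_isDown hv).mem_iff.2 (List.mem_cons_of_mem _ h3))
  refine ⟨v, h1, h2, hv, ?_⟩
  rcases List.mem_cons.1 ((perm_of_isDown hv).mem_iff.1 h3) with h | h
  · exact h.symm
  · exact (h4 h).elim

theorem exists_not_isDown_of_gained {x : ℕ} {a b : Fin (m + 1)} (hab : a ≤ b)
    (ha : x ∉ (T.filling a).flatten) (hb : x ∈ (T.filling b).flatten) :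
    ∃ v : Fin m, a ≤ v.castSucc ∧ v.succ ≤ b ∧ ¬ T.IsDown v ∧ T.stepLabel v = x := by
  obtain ⟨v, h1, h2, h3, h4⟩ :=
    exists_step (p := fun k => x ∉ (T.filling k).flatten) hab ha (not_not.2 hb)
  rw [not_not] at h4
  have hv : ¬ T.IsDown v := fun hv =>
    h3 ((perm_of_isDown hv).mem_iff.2 (List.mem_cons_of_mem _ h4))
  refine ⟨v, h1, h2, hv, ?_⟩
  rcases List.mem_cons.1 ((perm_of_not_isDown hv).mem_iff.1 h4) with h | h
  · exact h.symm
  · exact (h3 h).elim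

theorem exists_isDown_gt {v : Fin m} (hv : ¬ T.IsDown v) :
    ∃ w, v < w ∧ T.IsDown w ∧ T.stepLabel w = T.stepLabel v := by
  obtain ⟨w, h1, -, h3, h4⟩ := exists_isDown_of_lost (Fin.le_last _)
    (stepLabel_mem_of_not_isDown hv) (by rw [filling_last]; simp)
  exact ⟨w, Fin.succ_le_castSucc_iff.1 h1, h3, h4⟩

theorem exists_not_isDown_lt {w : Fin m} (hw : T.IsDown w) :
    ∃ v, v < w ∧ ¬ T.IsDown v ∧ T.stepLabel v = T.stepLabel w := by
  obtain ⟨v, -, h2, h3, h4⟩ := exists_not_isDown_of_gained (Fin.zero_le _)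
    (by rw [flatten_filling_zero]; simp) (stepLabel_mem_of_isDown hw)
  exact ⟨v, Fin.succ_le_castSucc_iff.1 h2, h3, h4⟩

theorem isDown_unique {v w : Fin m} (hv : T.IsDown v) (hw : T.IsDown w)
    (h : T.stepLabel v = T.stepLabel w) : v = w := by
  rw [stepLabel_of_isDown hv, stepLabel_of_isDown hw] at h
  exact countFrom_inj hv hw h

/-- Suppose `v < w`. The number is present just after `v` and absent just before `w`, so a down step
between them carries it; another one carries it after `w`. But down steps have distinct labels. -/
theorem not_isDown_unique {v w : Fin m} (hv : ¬ T.IsDown v) (hw : ¬ T.IsDown w)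
    (h : T.stepLabel v = T.stepLabel w) : v = w := by
  wlog hvw : v < w generalizing v w
  · rcases eq_or_lt_of_le (not_lt.1 hvw) with h' | h'
    · exact h'.symm
    · exact (this hw hv h.symm h').symm
  · obtain ⟨d, -, h2, h3, h4⟩ := exists_isDown_of_lost (Fin.succ_le_castSucc_iff.2 hvw)
      (stepLabel_mem_of_not_isDown hv) (h ▸ stepLabel_notMem_of_not_isDown hw)
    obtain ⟨d', h1', h3', h4'⟩ := exists_isDown_gt hw
    obtain rfl := isDown_unique h3 h3' (h4.trans (h.trans h4'.symm))
    exact (lt_asymm h1' (Fin.succ_le_castSucc_iff.1 h2)).elim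

theorem existsUnique_stepLabel_eq (v : Fin m) :
    ∃! w, v ≠ w ∧ T.stepLabel v = T.stepLabel w := by
  by_cases hv : T.IsDown v
  · obtain ⟨w, h1, h2, h3⟩ := exists_not_isDown_lt hv
    refine ⟨w, ⟨h1.ne', h3.symm⟩, fun u hu => ?_⟩
    by_cases hd : T.IsDown u
    · exact (hu.1 (isDown_unique hv hd hu.2)).elim
    · exact not_isDown_unique hd h2 (hu.2.symm.trans h3.symm)
  · obtain ⟨w, h1, h2, h3⟩ := exists_isDown_gt hv
    refine ⟨w, ⟨h1.ne, h3.symm⟩, fun u hu => ?_⟩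
    by_cases hd : T.IsDown u
    · exact isDown_unique hd h2 (hu.2.symm.trans h3.symm)
    · exact (hu.1 (not_isDown_unique hv hd hu.2)).elim

/-! ### From oscillating tableaux to matchings. -/

variable {n : ℕ}

/-- The matching of an oscillating tableau: an edge joins the step at which a number leaves the
tableau (read from right to left) with the step at which it is put in. -/
def toMatching (T : OscillatingTableau (2 * n)) : CompleteMatching n where
  val :=
    { verts := Set.univ
      Adj := fun v w => v ≠ w ∧ T.stepLabel v = T.stepLabel w
      adj_sub := fun h => h.1
      edge_vert := fun _ => Set.mem_univ _
      symm := ⟨fun _ _ h => ⟨h.1.symm, h.2.symm⟩⟩ }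
  property := SimpleGraph.Subgraph.isPerfectMatching_iff.2 existsUnique_stepLabel_eq

variable {T : OscillatingTableau (2 * n)}

theorem toMatching_adj {v w : Fin (2 * n)} :
    T.toMatching.1.Adj v w ↔ v ≠ w ∧ T.stepLabel v = T.stepLabel w := Iff.rfl

theorem toMatching_isStart {v : Fin (2 * n)} : T.toMatching.IsStart v ↔ ¬ T.IsDown v := by
  constructor
  · rintro ⟨w, hvw, h⟩ hv
    obtain ⟨u, h1, h2, h3⟩ := exists_not_isDown_lt hv
    obtain rfl := CompleteMatching.adj_unique h (toMatching_adj.2 ⟨h1.ne', h3.symm⟩)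
    exact lt_asymm h1 hvw
  · intro hv
    obtain ⟨w, h1, h2, h3⟩ := exists_isDown_gt hv
    exact ⟨w, h1, toMatching_adj.2 ⟨h1.ne, h3.symm⟩⟩

/-- At a down step both sides count the down steps weakly to the right; an up step inherits the
value from its partner. -/
theorem toMatching_label (v : Fin (2 * n)) : T.toMatching.label v = T.stepLabel v := by
  have hdown : ∀ w, T.IsDown w → T.toMatching.label w = T.stepLabel w := fun w hw => by
    rw [stepLabel_of_isDown hw]
    exact CompleteMatching.label_eq_countFrom
      (fun k => by rw [toMatching_isStart, not_not]) fun h => toMatching_isStart.1 h hw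
  by_cases hv : T.IsDown v
  · exact hdown v hv
  · obtain ⟨w, h1, h2, h3⟩ := exists_isDown_gt hv
    rw [← h3, ← hdown w h2]
    exact CompleteMatching.label_fst (p := (v, w))
      (CompleteMatching.mem_arcs.2 ⟨h1, toMatching_adj.2 ⟨h1.ne, h3.symm⟩⟩)

/-- The forward reading of the matching undoes the backward reading of `T` step by step: deletion
removes an added box, and insertion reverses unbumping. -/
theorem toMatching_filling (k : Fin (2 * n + 1)) :
    Eqv (T.toMatching.filling k) (T.filling k) := by
  induction k using Fin.induction with
  | zero =>
    have h := (T.filling_spec 0).2.1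
    rw [T.first, hasShape_bot_iff] at h
    exact h
  | succ v ih =>
    by_cases hv : T.IsDown v
    · rw [CompleteMatching.filling_succ_of_not_isStart fun h => toMatching_isStart.1 h hv,
        toMatching_label, stepLabel_of_isDown hv]
      refine (delete_eqv ih _).trans ?_
      rw [filling_castSucc_of_isDown hv]
      exact delete_addBox (label_notMem_filling_succ hv) _
    · rw [CompleteMatching.filling_succ_of_isStart (toMatching_isStart.2 hv), toMatching_label]
      exact (insert_eqv ih _).trans (insert_stepLabel_eqv hv)

theorem toTableau_toMatching : T.toMatching.toTableau = T := by
  have h : T.toMatching.toTableau.shape = T.shape := funext fun k =>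
    (T.toMatching.hasShape k).unique ((T.filling_spec k).2.1.congr (toMatching_filling k).symm)
  cases T
  simpa only [CompleteMatching.toTableau, mk.injEq] using h

end OscillatingTableau

/-! ### Recovering a matching from its oscillating tableau. -/

namespace CompleteMatching

variable {n : ℕ} {M : CompleteMatching n}

theorem adds_of_isStart {v : Fin (2 * n)} (hv : M.IsStart v) :
    ∃ i, Adds i (M.shape v.castSucc).rowLen (M.shape v.succ).rowLen ∧
      Eqv (unbump i (M.filling v.succ)).1 (M.filling v.castSucc) ∧
      (unbump i (M.filling v.succ)).2 = M.label v := by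
  obtain ⟨i, h, h'⟩ := (M.filling_spec v.castSucc).1.exists_unbump_insert (M.label v)
  rw [← filling_succ_of_isStart hv, (M.hasShape _).adds_iff (M.hasShape _)] at h
  rw [← filling_succ_of_isStart hv] at h'
  exact ⟨i, h, h'⟩

theorem adds_of_not_isStart {v : Fin (2 * n)} (hv : ¬ M.IsStart v) :
    ∃ i, Adds i (M.shape v.succ).rowLen (M.shape v.castSucc).rowLen ∧
      Eqv (addBox (M.label v) i (M.filling v.succ)) (M.filling v.castSucc) := by
  obtain ⟨i, h⟩ := exists_addBox_filling_succ hv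
  have h' := adds_addBox (M.label v) i (M.filling v.succ)
  rw [(M.hasShape _).adds_iff ((M.hasShape _).congr h.symm)] at h'
  exact ⟨i, h', h⟩

theorem isDown_toTableau {v : Fin (2 * n)} : M.toTableau.IsDown v ↔ ¬ M.IsStart v := by
  constructor
  · intro h hv
    obtain ⟨i, h', -⟩ := adds_of_isStart hv
    exact OscillatingTableau.not_isDown_of_covBy (YoungDiagram.covBy_of_adds h') h
  · intro hv
    obtain ⟨i, h', -⟩ := adds_of_not_isStart hv
    exact YoungDiagram.covBy_of_adds h'

theorem label_toTableau {v : Fin (2 * n)} (hv : ¬ M.IsStart v) :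
    M.toTableau.label v = M.label v :=
  (label_eq_countFrom (fun _ => isDown_toTableau) hv).symm

/-- Both readings have an empty filling at the right end, and the shapes give the row to unbump or
extend. Thus the shapes alone determine the entries. -/
theorem filling_toTableau (k : Fin (2 * n + 1)) : Eqv (M.toTableau.filling k) (M.filling k) := by
  induction k using Fin.reverseInduction with
  | last =>
    rw [OscillatingTableau.filling_last]
    exact M.filling_last
  | cast v ih =>
    by_cases hv : M.IsStart v
    · obtain ⟨i, h1, h2, -⟩ := adds_of_isStart hv
      rw [OscillatingTableau.filling_castSucc_of_not_isDown fun h => isDown_toTableau.1 h hv,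
        OscillatingTableau.changedRow_of_adds h1]
      exact (unbump_eqv ih i).1.trans h2
    · obtain ⟨i, h1, h2⟩ := adds_of_not_isStart hv
      rw [OscillatingTableau.filling_castSucc_of_isDown (isDown_toTableau.2 hv),
        OscillatingTableau.changedRow_of_adds' h1, label_toTableau hv]
      exact (addBox_eqv ih _ _).trans h2

theorem stepLabel_toTableau (v : Fin (2 * n)) : M.toTableau.stepLabel v = M.label v := by
  by_cases hv : M.IsStart v
  · obtain ⟨i, h1, -, h3⟩ := adds_of_isStart hv
    rw [OscillatingTableau.stepLabel_of_not_isDown fun h => isDown_toTableau.1 h hv,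
      OscillatingTableau.changedRow_of_adds h1, (unbump_eqv (filling_toTableau _) i).2, h3]
  · rw [OscillatingTableau.stepLabel_of_isDown (isDown_toTableau.2 hv), label_toTableau hv]

theorem toMatching_toTableau : M.toTableau.toMatching = M := by
  refine Subtype.ext (SimpleGraph.Subgraph.ext ?_ ?_)
  · exact M.2.2.verts_eq_univ.symm
  · ext v w
    rw [OscillatingTableau.toMatching_adj, stepLabel_toTableau, stepLabel_toTableau, adj_iff]

/-! ### Weights -/

/-- Only the insertion of the label of `p` itself could place it elsewhere; other insertions keep it
in the first column, and deletions do not move entries. -/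
theorem firstColumn_filling {p : Fin (2 * n) × Fin (2 * n)} (hp : p ∈ M.arcs)
    (hn : ¬ M.IsNested p) (k : Fin (2 * n + 1)) : FirstColumn (M.label p.2) (M.filling k) := by
  induction k using Fin.induction with
  | zero =>
    intro i j h
    simp [filling_zero, HasEntry] at h
  | succ v ih =>
    obtain ⟨h1, -, h3⟩ := M.filling_spec v.castSucc
    by_cases hv : M.IsStart v
    · rw [filling_succ_of_isStart hv]
      by_cases hl : M.label v = M.label p.2
      · obtain ⟨w, hw⟩ := exists_arc_of_isStart hv
        obtain rfl : (v, w) = p := label_inj hw hp ((label_fst hw).symm.trans hl)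
        rw [hl]
        refine (h1.firstColumn_insert ih).2 fun z t hz => ?_
        have hz' : z ∈ (M.filling v.castSucc).flatten :=
          mem_flatten_iff.2 ⟨0, by rw [hz]; exact List.mem_cons_self⟩
        obtain ⟨q, hq, hqv, -, rfl⟩ := (h3 z).1 hz'
        rw [Fin.castSucc_lt_castSucc_iff] at hqv
        -- An edge `q` open when `p` starts must end before `p` does, since otherwise it would nest
        -- `p`; its label is therefore larger.
        refine label_lt hq hp (lt_of_not_ge fun hle => ?_)
        rcases eq_or_lt_of_le hle with he | hlt
        · obtain rfl := arc_eq_of_snd hp hq he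
          exact lt_irrefl _ hqv
        · exact hn ⟨q, hq, hqv, hlt⟩
      · exact (h1.firstColumn_insert ih).1 _ hl
    · obtain ⟨i, -, h⟩ := adds_of_not_isStart hv
      exact (ih.congr h.symm).of_addBox

/-- The moment to look at is right after `p` starts: the nesting edge is then open and carries a
smaller label. -/
theorem exists_hasEntry_of_isNested {p : Fin (2 * n) × Fin (2 * n)} (hp : p ∈ M.arcs)
    (hn : M.IsNested p) : ∃ j ≠ 0, (M.filling p.1.succ).HasEntry 0 j (M.label p.2) := by
  obtain ⟨q, hq, h1, h2⟩ := hn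
  obtain ⟨h3, -, h4⟩ := M.filling_spec p.1.castSucc
  rw [filling_succ_of_isStart (isStart_fst hp), label_fst hp]
  refine h3.exists_hasEntry_insert ((h4 _).2 ⟨q, hq, ?_, ?_, rfl⟩) (label_lt hp hq h2)
  · exact Fin.castSucc_lt_castSucc_iff.2 h1
  · exact Fin.castSucc_le_castSucc_iff.2 ((mem_arcs.1 hp).1.trans h2).le

theorem firstColumnOnly_iff {p : Fin (2 * n) × Fin (2 * n)} (hp : p ∈ M.arcs) :
    M.toTableau.FirstColumnOnly (M.label p.2) ↔ ¬ M.IsNested p := by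
  constructor
  · intro h hn
    obtain ⟨j, hj, he⟩ := exists_hasEntry_of_isNested hp hn
    refine hj (h p.1.succ 0 j ?_)
    change ((M.toTableau.filling _).row 0)[j]? = _
    rw [filling_toTableau]
    exact he
  · intro hn k
    exact (firstColumn_filling hp hn k).congr (filling_toTableau k).symm

open Classical in
theorem numbers_toTableau : M.toTableau.numbers = M.arcs.image fun p => M.label p.2 := by
  ext x
  simp only [OscillatingTableau.numbers, Finset.mem_image, Finset.mem_filter, Finset.mem_univ,
    true_and, isDown_toTableau]
  constructor
  · rintro ⟨v, hv, rfl⟩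
    obtain ⟨u, hu⟩ := exists_arc_of_not_isStart hv
    exact ⟨(u, v), hu, (label_toTableau hv).symm⟩
  · rintro ⟨p, hp, rfl⟩
    exact ⟨p.2, not_isStart_snd hp, label_toTableau (not_isStart_snd hp)⟩

theorem weight_toTableau : M.toTableau.weight = M.weight := by
  classical
  rw [OscillatingTableau.weight, weight, numbers_toTableau,
    Finset.prod_image fun p hp q hq h => label_inj hp hq h]
  refine Finset.prod_congr rfl fun p hp => ?_
  by_cases hn : M.IsNested p
  · rw [if_neg fun h => (firstColumnOnly_iff hp).1 h hn, if_pos hn]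
  · rw [if_pos ((firstColumnOnly_iff hp).2 hn), if_neg hn]

end CompleteMatching

end

/-- The map which sends a complete matching to the sequence of shapes obtained by RSK insertion and
deletion is a weight-preserving bijection onto the oscillating tableaux of length `2 * n`. -/
theorem theoremt (n : ℕ) :
    ∃ e : CompleteMatching n ≃ OscillatingTableau (2 * n),
      (∀ (M : CompleteMatching n) (k : Fin (2 * n + 1)),
        ((e M).shape k : Set (ℕ × ℕ)) = (M.filling k).boxes) ∧
      ∀ M : CompleteMatching n, (e M).weight = M.weight :=
  ⟨⟨CompleteMatching.toTableau, OscillatingTableau.toMatching,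
      fun _ => CompleteMatching.toMatching_toTableau,
      fun _ => OscillatingTableau.toTableau_toMatching⟩,
    fun M k => (M.hasShape k).coe_eq_boxes, fun _ => CompleteMatching.weight_toTableau⟩
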